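/- **Definitions.** A map is a finite graph embedded in a connected closed surface such that every face is an open disc. Its barycentric subdivision $B_P$ is the triangulation of the surface whose vertices of colour $0,1,2$ are the vertices, edges and faces of the map $P$; its triangles (equivalently, the flags (vertex, edge, face)) are called chambers. $\mathrm{Aut}(P)=\mathrm{Aut}(B_P)$ is the group of colour-preserving automorphisms of $B_P$, orientation-reversing ones included. A map is *polyhedral* if its graph is 3-connected, the closure of every face is a closed disc, and the intersection of the closures of any two faces is connected (possibly empty). *Genus $1$* means that the surface is the torus. The size of a face is the length of its boundary walk. Let $T_H$ be the regular hexagonal tiling of the plane with edge length $1$, with coordinates with respect to two unit vectors at an angle of $60^\circ$, the second one obtained from the first by a counterclockwise rotation, chosen such that an integral point $(x,y)$ is the centre of a face if $3\mid x-y$ and a vertex otherwise. For integers $l\ge 1$ and $m\ge 0$ with $l=m$ or $m=0$, the *Goldberg–Coxeter operation* $\mathrm{GC}(l,m)$ is the triangle with corners $$v_0=(l,m),\qquad v_1=\left(\tfrac{l-m}{2},\tfrac{l+2m}{2}\right),\qquad v_2=(0,0)$$ cut out of the barycentric subdivision $B_{T_H}$. It is applied to a map $P$ by gluing a copy of this subdivided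 triangle (or of its mirror image, depending on the orientation of the chamber) into every chamber of $B_P$, with $v_i$ placed at the vertex of colour $i$ of the chamber. The resulting coloured triangulation is the barycentric subdivision of a map on the same surface, the result $O(P)$ of applying $O=\mathrm{GC}(l,m)$ to $P$. The operation $\mathrm{GC}(1,0)$ is the identity. An operation $O$ *increases the symmetry* of $P$ if $|\mathrm{Aut}(O(P))|>|\mathrm{Aut}(P)|$. **Lemma.** Let $P$ be a polyhedral map of genus $1$ all of whose faces have size $6$. Then for all integers $l\ge 1$ and $m\ge 0$ with $l=m$ or $m=0$ and $(l,m)\neq(1,0)$, the operation $\mathrm{GC}(l,m)$ increases the symmetry of $P$. -/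

import Mathlib

universe u

/-! ### Maps on closed surfaces, given by their chambers (flags) -/

/-- A (finite) map on a closed surface, given by its barycentric subdivision: the chambers are the
triangles of the barycentric subdivision (equivalently the flags (vertex, edge, face)), and `r i C`
is the chamber that shares with `C` the edge opposite to the vertex of colour `i` of `C`, that is,
the chamber that differs from `C` exactly in its vertex (`i = 0`), edge (`i = 1`) or
face (`i = 2`). The last two conditions say that every vertex of colour `1` of the barycentric
subdivision lies in exactly four chambers. -/
structure SurfaceMap where
  Chamber : Type u
  finite_chamber : Finite Chamber
  r : Fin 3 → Chamber → Chamber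
  r_r : ∀ i C, r i (r i C) = C
  r_ne : ∀ i C, r i C ≠ C
  r_comm : ∀ C, r 0 (r 2 C) = r 2 (r 0 C)
  r_zero_ne_r_two : ∀ C, r 0 C ≠ r 2 C

namespace SurfaceMap

variable (P : SurfaceMap.{u})

/-- The vertices of colour `i` of the barycentric subdivision, for `i = 0, 1, 2` these are
the vertices, the edges and the faces of the map: two chambers have the same vertex of
colour `i` if and only if they are connected by a sequence of adjacencies `r j` with `j ≠ i`. -/
def Cell (i : Fin 3) : Type u :=
  Quot fun C D : P.Chamber => ∃ j, j ≠ i ∧ D = P.r j C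

abbrev Vertex : Type u := P.Cell 0
abbrev Edge : Type u := P.Cell 1
abbrev Face : Type u := P.Cell 2

/-- The vertex of colour `i` of a chamber. -/
def cell (i : Fin 3) (C : P.Chamber) : P.Cell i := Quot.mk _ C

/-- Incidence of vertices, edges and faces. -/
def Incident {i j : Fin 3} (x : P.Cell i) (y : P.Cell j) : Prop :=
  ∃ C : P.Chamber, P.cell i C = x ∧ P.cell j C = y

/-- The size of a face: the length of its boundary walk. Every edge traversed by the boundary walk
contributes two chambers to the face. -/
noncomputable def faceSize (f : P.Face) : ℕ :=
  Nat.card {C : P.Chamber // P.cell 2 C = f} / 2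

/-- The underlying graph (only adjacency of distinct vertices is recorded). -/
def graph : SimpleGraph P.Vertex where
  Adj x y := x ≠ y ∧ ∃ C : P.Chamber, P.cell 0 C = x ∧ P.cell 0 (P.r 0 C) = y
  symm := ⟨by
    rintro x y ⟨hxy, C, hx, hy⟩
    exact ⟨hxy.symm, P.r 0 C, hy, by rw [P.r_r]; exact hx⟩⟩
  loopless := ⟨fun _ h => h.1 rfl⟩

/-- The surface is connected. -/
def IsConnected : Prop :=
  Nonempty P.Chamber ∧
    ∀ C D : P.Chamber, Relation.ReflTransGen (fun A B => ∃ i, B = P.r i A) C D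

/-- The surface is orientable: the chambers can be coloured with two colours (orientations)
such that adjacent chambers have different colours. -/
def IsOrientable : Prop :=
  ∃ o : P.Chamber → Bool, ∀ i C, o (P.r i C) = !(o C)

/-- The map is a map on the connected orientable surface of genus `g`
(with Euler characteristic `2 - 2 g`). -/
def HasGenus (g : ℕ) : Prop :=
  P.IsConnected ∧ P.IsOrientable ∧
    (Nat.card P.Vertex : ℤ) - Nat.card P.Edge + Nat.card P.Face = 2 - 2 * g

/-- A graph is 3-connected if it has at least 4 vertices and no set of at most two vertices
separates it. -/
def _root_.SimpleGraph.IsThreeConnected {V : Type u} (G : SimpleGraph V) : Prop :=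
  4 ≤ Nat.card V ∧ ∀ S : Finset V, S.card ≤ 2 → (G.induce {x : V | x ∉ S}).Connected

/-- The closure of the face `f` is a closed disc: its boundary walk passes at most once through
every vertex and every edge. -/
def FaceIsDisc (f : P.Face) : Prop :=
  ∀ C D : P.Chamber, P.cell 2 C = f → P.cell 2 D = f →
    (P.cell 0 C = P.cell 0 D → D = C ∨ D = P.r 1 C) ∧
    (P.cell 1 C = P.cell 1 D → D = C ∨ D = P.r 0 C)

/-- The intersection of the closures of two distinct faces `f` and `g` is connected (or empty): any
two vertices in this intersection are joined by a path of edges in this intersection. -/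
def FaceInterConnected (f g : P.Face) : Prop :=
  ∀ x y : P.Vertex, P.Incident x f → P.Incident x g → P.Incident y f → P.Incident y g →
    Relation.ReflTransGen
      (fun a b => ∃ e : P.Edge, P.Incident e f ∧ P.Incident e g ∧
        P.Incident a e ∧ P.Incident b e) x y

/-- Polyhedral maps: the graph is 3-connected, the closure of every face is a closed disc
and the closures of any two faces have connected intersection. -/
structure IsPolyhedral : Prop where
  threeConnected : P.graph.IsThreeConnected
  disc : ∀ f : P.Face, P.FaceIsDisc f
  inter : ∀ f g : P.Face, f ≠ g → P.FaceInterConnected f g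

/-- The automorphisms of a map, as colour preserving automorphisms of the barycentric
subdivision. -/
def Aut : Type u :=
  {φ : Equiv.Perm P.Chamber // ∀ i C, φ (P.r i C) = P.r i (φ C)}

end SurfaceMap

/-! ### Gluing a subdivided triangle into every chamber -/

/-- The chambers of a subdivided triangle with corners `v₀, v₁, v₂` and 3-coloured vertices, such
as those of a local symmetry preserving operation. If the edge of a chamber `c` opposite to its
vertex of colour `i` lies in another chamber `c'`, then `adj i c = inl c'`. Otherwise
this edge lies in the boundary of the triangle, and then `adj i c = inr k` where `k` is such that
the edge lies on the side opposite to the corner `v_k`. The last four conditions are about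
vertices of colour `1`: in the interior they have degree four, on the boundary they have degree
three, except that the corner `v₁` has degree two if it has colour `1`, and the corners `v₀` and
`v₂` do not have colour `1`. -/
structure LocalOperation where
  Chamber : Type
  finite_chamber : Finite Chamber
  adj : Fin 3 → Chamber → Chamber ⊕ Fin 3
  adj_symm : ∀ i c c', adj i c = .inl c' → adj i c' = .inl c
  adj_ne : ∀ i c, adj i c ≠ .inl c
  adj_inner : ∀ c a b, adj 0 c = .inl a → adj 2 c = .inl b →
    a ≠ b ∧ ∃ d, adj 2 a = .inl d ∧ adj 0 b = .inl d
  adj_bdry_two : ∀ c a k, adj 0 c = .inl a → adj 2 c = .inr k → adj 2 a = .inr k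
  adj_bdry_zero : ∀ c b k, adj 0 c = .inr k → adj 2 c = .inl b → adj 0 b = .inr k
  adj_corner : ∀ c j k, adj 0 c = .inr j → adj 2 c = .inr k →
    (j = 0 ∧ k = 2) ∨ (j = 2 ∧ k = 0)

namespace LocalOperation

/-- The chamber adjacent to the copy of `c` in the chamber `C` of `P`. -/
def glue (O : LocalOperation) (P : SurfaceMap.{u}) (i : Fin 3) (x : P.Chamber × O.Chamber) :
    P.Chamber × O.Chamber :=
  match O.adj i x.2 with
  | .inl c' => (x.1, c')
  | .inr k => (P.r k x.1, x.2)

theorem glue_inl {O : LocalOperation} {P : SurfaceMap.{u}} {i : Fin 3} {C : P.Chamber}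
    {c c' : O.Chamber} (h : O.adj i c = .inl c') : O.glue P i (C, c) = (C, c') := by
  simp [glue, h]

theorem glue_inr {O : LocalOperation} {P : SurfaceMap.{u}} {i k : Fin 3} {C : P.Chamber}
    {c : O.Chamber} (h : O.adj i c = .inr k) : O.glue P i (C, c) = (P.r k C, c) := by
  simp [glue, h]

/-- The result `O(P)` of applying the operation `O` to `P`: a copy of `O` (mirrored according
to the orientation) is glued into every chamber of `P`, with `v_i` at the vertex of
colour `i`. So across the side of a copy opposite to `v_k` lies the copy of the same
chamber of `O` in the `k`-adjacent chamber of `P`. -/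
def apply (O : LocalOperation) (P : SurfaceMap.{u}) : SurfaceMap.{u} where
  Chamber := P.Chamber × O.Chamber
  finite_chamber := by
    have := O.finite_chamber
    have := P.finite_chamber
    infer_instance
  r := O.glue P
  r_r := by
    rintro i ⟨C, c⟩
    rcases h : O.adj i c with c' | k
    · rw [glue_inl h, glue_inl (O.adj_symm _ _ _ h)]
    · rw [glue_inr h, glue_inr h, P.r_r]
  r_ne := by
    rintro i ⟨C, c⟩
    rcases h : O.adj i c with c' | k
    · rw [glue_inl h]
      intro h'
      obtain rfl : c' = c := congrArg Prod.snd h'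
      exact O.adj_ne _ _ h
    · rw [glue_inr h]
      exact fun h' => P.r_ne _ _ (congrArg Prod.fst h')
  r_comm := by
    rintro ⟨C, c⟩
    rcases h0 : O.adj 0 c with a | j <;> rcases h2 : O.adj 2 c with b | k
    · obtain ⟨-, d, hd, hd'⟩ := O.adj_inner _ _ _ h0 h2
      rw [glue_inl h0, glue_inl h2, glue_inl hd, glue_inl hd']
    · rw [glue_inl h0, glue_inr h2, glue_inl h0, glue_inr (O.adj_bdry_two _ _ _ h0 h2)]
    · rw [glue_inr h0, glue_inl h2, glue_inl h2, glue_inr (O.adj_bdry_zero _ _ _ h0 h2)]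
    · rw [glue_inr h0, glue_inr h2, glue_inr h0, glue_inr h2]
      rcases O.adj_corner _ _ _ h0 h2 with ⟨rfl, rfl⟩ | ⟨rfl, rfl⟩
      · rw [P.r_comm]
      · rw [P.r_comm]
  r_zero_ne_r_two := by
    rintro ⟨C, c⟩
    rcases h0 : O.adj 0 c with a | j <;> rcases h2 : O.adj 2 c with b | k
    · rw [glue_inl h0, glue_inl h2]
      exact fun h => (O.adj_inner _ _ _ h0 h2).1 (congrArg Prod.snd h)
    · rw [glue_inl h0, glue_inr h2]
      intro h
      obtain rfl : a = c := congrArg Prod.snd h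
      exact O.adj_ne _ _ h0
    · rw [glue_inr h0, glue_inl h2]
      intro h
      obtain rfl : c = b := congrArg Prod.snd h
      exact O.adj_ne _ _ h2
    · rw [glue_inr h0, glue_inr h2]
      intro h
      have h' : P.r j C = P.r k C := congrArg Prod.fst h
      rcases O.adj_corner _ _ _ h0 h2 with ⟨rfl, rfl⟩ | ⟨rfl, rfl⟩
      · exact P.r_zero_ne_r_two _ h'
      · exact P.r_zero_ne_r_two _ h'.symm

/-- `O` increases the symmetry of `P`: the map `O(P)` has more automorphisms than `P`. -/
def IncreasesSymmetry (O : LocalOperation) (P : SurfaceMap.{u}) : Prop :=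
  Nat.card P.Aut < Nat.card (O.apply P).Aut

end LocalOperation

/-! ### The hexagonal tiling and the Goldberg–Coxeter operations -/

/-- The squared Euclidean length of the vector with coordinates `p`, with respect to two unit
vectors that form an angle of 60 degrees. -/
def hexNorm (p : ℤ × ℤ) : ℤ := p.1 ^ 2 + p.1 * p.2 + p.2 ^ 2

/-- A chamber of the barycentric subdivision of the regular hexagonal tiling with edge length `1`,
in coordinates with respect to two unit vectors that form an angle of 60 degrees. A point with
integral coordinates `(x, y)` is the centre of a face if `3 ∣ x - y` and a vertex otherwise. The
chamber is given by the centre `f` of its face, its vertex `v` and the other end `w` of its edge. -/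
@[ext]
structure HexChamber where
  f : ℤ × ℤ
  v : ℤ × ℤ
  w : ℤ × ℤ
  face_center : 3 ∣ f.1 - f.2
  norm_v : hexNorm (v - f) = 1
  norm_w : hexNorm (w - f) = 1
  norm_edge : hexNorm (v - w) = 1

namespace HexChamber

/-- The corners of the chamber: its vertex, the midpoint of its edge, the centre of its face. -/
def corner (c : HexChamber) : Fin 3 → ℚ × ℚ :=
  ![(c.v.1, c.v.2), ((c.v.1 + c.w.1) / 2, (c.v.2 + c.w.2) / 2), (c.f.1, c.f.2)]

theorem hexNorm_eq_one {p : ℤ × ℤ} (h : hexNorm p = 1) :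
    (p.1 = 1 ∧ p.2 = 0) ∨ (p.1 = 0 ∧ p.2 = 1) ∨ (p.1 = -1 ∧ p.2 = 1) ∨
    (p.1 = -1 ∧ p.2 = 0) ∨ (p.1 = 0 ∧ p.2 = -1) ∨ (p.1 = 1 ∧ p.2 = -1) := by
  obtain ⟨x, y⟩ := p
  simp only [hexNorm] at h ⊢
  have hx : -1 ≤ x := by nlinarith [sq_nonneg (x + 2 * y)]
  have hx' : x ≤ 1 := by nlinarith [sq_nonneg (x + 2 * y)]
  have hy : -1 ≤ y := by nlinarith [sq_nonneg (2 * x + y)]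
  have hy' : y ≤ 1 := by nlinarith [sq_nonneg (2 * x + y)]
  interval_cases x <;> interval_cases y <;> simp_all

/-- The chamber that shares with `c` the two corners of colour different from `i`. -/
def flip (i : Fin 3) (c : HexChamber) : HexChamber :=
  match i with
  | 0 => ⟨c.f, c.w, c.v, c.face_center, c.norm_w, c.norm_v, by
      rw [← c.norm_edge]; simp only [hexNorm, Prod.fst_sub, Prod.snd_sub]; ring⟩
  | 1 => ⟨c.f, c.v, c.v - c.w + c.f, c.face_center, c.norm_v, by
      rw [← c.norm_edge]; simp, by
      rw [← c.norm_w]; congr 1; ring⟩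
  | 2 => ⟨c.v + c.w - c.f, c.v, c.w, by
      have h1 := hexNorm_eq_one c.norm_v
      have h2 := hexNorm_eq_one c.norm_w
      have h3 := hexNorm_eq_one c.norm_edge
      have h := c.face_center
      simp only [Prod.fst_sub, Prod.snd_sub, Prod.fst_add, Prod.snd_add] at h1 h2 h3 ⊢
      omega, by
      rw [← c.norm_w]; simp only [hexNorm, Prod.fst_sub, Prod.snd_sub, Prod.fst_add, Prod.snd_add]
      ring, by
      rw [← c.norm_v]; simp only [hexNorm, Prod.fst_sub, Prod.snd_sub, Prod.fst_add, Prod.snd_add]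
      ring, c.norm_edge⟩

theorem flip_flip (i : Fin 3) (c : HexChamber) : (c.flip i).flip i = c := by
  fin_cases i
  · rfl
  · ext <;> simp [flip] <;> ring
  · ext <;> simp [flip]

end HexChamber

/-- The corners `v₀ = (l, m)`, `v₁ = ((l - m) / 2, (l + 2 m) / 2)` and `v₂ = (0, 0)` of the triangle
that is cut out of the hexagonal tiling. -/
def gcVertex (l m : ℕ) : Fin 3 → ℚ × ℚ :=
  ![((l : ℚ), (m : ℚ)), (((l : ℚ) - m) / 2, ((l : ℚ) + 2 * m) / 2), (0, 0)]

def gcTriangle (l m : ℕ) : Set (ℚ × ℚ) := convexHull ℚ (Set.range (gcVertex l m))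

/-- The side opposite to `v_k`. -/
def gcSide (l m : ℕ) (k : Fin 3) : Set (ℚ × ℚ) := convexHull ℚ (gcVertex l m '' {j | j ≠ k})

/-- The chamber `c` lies in the triangle. -/
def HexChamber.InTriangle (l m : ℕ) (c : HexChamber) : Prop :=
  ∀ i, c.corner i ∈ gcTriangle l m

/-- The edge of `c` opposite to its corner of colour `i` lies on the side opposite to `v_k`. -/
def HexChamber.EdgeOnSide (l m : ℕ) (i k : Fin 3) (c : HexChamber) : Prop :=
  ∀ j, j ≠ i → c.corner j ∈ gcSide l m k

open Classical in
/-- The number `k` such that the edge of `c` opposite to its corner of colour `i` lies on the side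
opposite to `v_k`, if there is one. -/
noncomputable def HexChamber.edgeSide (l m : ℕ) (i : Fin 3) (c : HexChamber) : Fin 3 :=
  if c.EdgeOnSide l m i 0 then 0 else if c.EdgeOnSide l m i 1 then 1 else 2

theorem mem_convexHull_image_iff (V : Fin 3 → ℚ × ℚ) (s : Set (Fin 3)) (p : ℚ × ℚ) :
    p ∈ convexHull ℚ (V '' s) ↔ ∃ a : Fin 3 → ℚ, (∀ j, 0 ≤ a j) ∧ (∀ j, j ∉ s → a j = 0) ∧
      a 0 + a 1 + a 2 = 1 ∧ p = a 0 • V 0 + a 1 • V 1 + a 2 • V 2 := by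
  classical
  constructor
  · intro h
    refine convexHull_min (t := {p | ∃ a : Fin 3 → ℚ, (∀ j, 0 ≤ a j) ∧ (∀ j, j ∉ s → a j = 0) ∧
      a 0 + a 1 + a 2 = 1 ∧ p = a 0 • V 0 + a 1 • V 1 + a 2 • V 2}) ?_ ?_ h
    · rintro _ ⟨j, hj, rfl⟩
      refine ⟨Pi.single j 1, fun k => ?_, fun k hk => ?_, ?_, ?_⟩
      · by_cases h : k = j
        · subst h; simp
        · simp [h]
      · have h : k ≠ j := fun h => hk (h ▸ hj)
        simp [h]
      · fin_cases j <;> simp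
      · fin_cases j <;> simp
    · rintro x ⟨a, ha, ha', ha1, rfl⟩ y ⟨b, hb, hb', hb1, rfl⟩ t u ht hu htu
      refine ⟨fun j => t * a j + u * b j, fun j => ?_, fun j hj => ?_, ?_, ?_⟩
      · have := ha j
        have := hb j
        positivity
      · simp [ha' j hj, hb' j hj]
      · linear_combination t * ha1 + u * hb1 + htu
      · module
  · rintro ⟨a, ha, ha', ha1, rfl⟩
    have h := (convex_convexHull ℚ (V '' s)).sum_mem (t := Finset.univ.filter (· ∈ s))
      (w := a) (z := V) (fun i _ => ha i) ?_ ?_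
    · rw [Finset.sum_filter_of_ne, Fin.sum_univ_three] at h
      · exact h
      · intro j _ hj
        by_contra hjs
        exact hj (by rw [ha' j hjs, zero_smul])
    · rw [Finset.sum_filter_of_ne, Fin.sum_univ_three, ha1]
      intro j _ hj
      by_contra hjs
      exact hj (ha' j hjs)
    · intro j hj
      exact subset_convexHull ℚ _ ⟨j, (Finset.mem_filter.1 hj).2, rfl⟩

theorem mem_gcTriangle_zero {l : ℕ} (hl : 0 < l) (x y : ℚ) :
    (x, y) ∈ gcTriangle l 0 ↔ 0 ≤ y ∧ y ≤ x ∧ x + y ≤ l := by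
  have hl' : (0 : ℚ) < l := by exact_mod_cast hl
  rw [gcTriangle, ← Set.image_univ, mem_convexHull_image_iff]
  simp only [gcVertex, Prod.ext_iff, Prod.fst_add, Prod.snd_add, Prod.smul_fst, Prod.smul_snd,
    Matrix.cons_val_zero, Matrix.cons_val_one, Matrix.cons_val, Fin.forall_fin_succ, smul_eq_mul,
    Nat.cast_zero]
  constructor
  · rintro ⟨a, ⟨h0, h1, h2, -⟩, -, hs, hx, hy⟩
    simp at h0 h1 h2
    refine ⟨?_, ?_, ?_⟩ <;> nlinarith
  · rintro ⟨h0, h1, h2⟩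
    refine ⟨![(x - y) / l, 2 * y / l, 1 - (x + y) / l], ?_, ?_, ?_, ?_, ?_⟩
    · simp
      refine ⟨div_nonneg (by linarith) hl'.le, by positivity, ?_⟩
      rw [div_le_one hl']; exact h2
    · simp
    · simp; field_simp; ring
    · simp; field_simp; ring
    · simp; field_simp

theorem mem_gcTriangle_self {l : ℕ} (hl : 0 < l) (x y : ℚ) :
    (x, y) ∈ gcTriangle l l ↔ 0 ≤ x ∧ x ≤ y ∧ x + 2 * y ≤ 3 * l := by
  have hl' : (0 : ℚ) < l := by exact_mod_cast hl
  rw [gcTriangle, ← Set.image_univ, mem_convexHull_image_iff]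
  simp only [gcVertex, Prod.ext_iff, Prod.fst_add, Prod.snd_add, Prod.smul_fst, Prod.smul_snd,
    Matrix.cons_val_zero, Matrix.cons_val_one, Matrix.cons_val, Fin.forall_fin_succ, smul_eq_mul]
  constructor
  · rintro ⟨a, ⟨h0, h1, h2, -⟩, -, hs, hx, hy⟩
    simp at h0 h1 h2
    refine ⟨?_, ?_, ?_⟩ <;> nlinarith
  · rintro ⟨h0, h1, h2⟩
    refine ⟨![x / l, 2 * (y - x) / (3 * l), 1 - (x + 2 * y) / (3 * l)], ?_, ?_, ?_, ?_, ?_⟩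
    · simp
      refine ⟨by positivity, div_nonneg (by linarith) (by linarith), ?_⟩
      rw [div_le_one (by linarith)]; exact h2
    · simp
    · simp; field_simp; ring
    · simp; field_simp
    · simp; field_simp; ring

theorem mem_gcSide_zero {l : ℕ} (hl : 0 < l) (k : Fin 3) (x y : ℚ) :
    (x, y) ∈ gcSide l 0 k ↔ (0 ≤ y ∧ y ≤ x ∧ x + y ≤ l) ∧ ![x - y, y, l - (x + y)] k = 0 := by
  have hl' : (0 : ℚ) < l := by exact_mod_cast hl
  rw [gcSide, mem_convexHull_image_iff]
  simp only [gcVertex, Prod.ext_iff, Prod.fst_add, Prod.snd_add, Prod.smul_fst, Prod.smul_snd,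
    Matrix.cons_val_zero, Matrix.cons_val_one, Matrix.cons_val, smul_eq_mul,
    Nat.cast_zero, Set.mem_ofPred_eq, not_not, forall_eq]
  constructor
  · rintro ⟨a, h, hk, hs, hx, hy⟩
    have h0 := h 0
    have h1 := h 1
    have h2 := h 2
    refine ⟨⟨?_, ?_, ?_⟩, ?_⟩
    · nlinarith
    · nlinarith
    · nlinarith
    · fin_cases k
      · simp at hk ⊢; rw [hx, hy, hk]; ring
      · simp at hk ⊢; rw [hy, hk]; ring
      · simp at hk ⊢; rw [hx, hy]; linear_combination (-(l : ℚ)) * hs + (l : ℚ) * hk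
  · rintro ⟨⟨h0, h1, h2⟩, hk⟩
    refine ⟨![(x - y) / l, 2 * y / l, 1 - (x + y) / l], ?_, ?_, ?_, ?_, ?_⟩
    · simp only [Fin.forall_fin_succ]
      simp
      refine ⟨div_nonneg (by linarith) hl'.le, by positivity, ?_⟩
      rw [div_le_one hl']; exact h2
    · fin_cases k <;> simp at hk ⊢
      · left; exact hk
      · left; exact hk
      · field_simp; linarith
    · simp; field_simp; ring
    · simp; field_simp; ring
    · simp; field_simp

theorem mem_gcSide_self {l : ℕ} (hl : 0 < l) (k : Fin 3) (x y : ℚ) :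
    (x, y) ∈ gcSide l l k ↔
      (0 ≤ x ∧ x ≤ y ∧ x + 2 * y ≤ 3 * l) ∧ ![x, y - x, 3 * l - (x + 2 * y)] k = 0 := by
  have hl' : (0 : ℚ) < l := by exact_mod_cast hl
  rw [gcSide, mem_convexHull_image_iff]
  simp only [gcVertex, Prod.ext_iff, Prod.fst_add, Prod.snd_add, Prod.smul_fst, Prod.smul_snd,
    Matrix.cons_val_zero, Matrix.cons_val_one, Matrix.cons_val, smul_eq_mul,
    Set.mem_ofPred_eq, not_not, forall_eq]
  constructor
  · rintro ⟨a, h, hk, hs, hx, hy⟩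
    have h0 := h 0
    have h1 := h 1
    have h2 := h 2
    refine ⟨⟨?_, ?_, ?_⟩, ?_⟩
    · nlinarith
    · nlinarith
    · nlinarith
    · fin_cases k
      · simp at hk ⊢; rw [hx, hk]; ring
      · simp at hk ⊢; rw [hx, hy, hk]; ring
      · simp at hk ⊢; rw [hx, hy]; linear_combination (-3 * (l : ℚ)) * hs + 3 * (l : ℚ) * hk
  · rintro ⟨⟨h0, h1, h2⟩, hk⟩
    refine ⟨![x / l, 2 * (y - x) / (3 * l), 1 - (x + 2 * y) / (3 * l)], ?_, ?_, ?_, ?_, ?_⟩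
    · simp only [Fin.forall_fin_succ]
      simp
      refine ⟨by positivity, div_nonneg (by linarith) (by linarith), ?_⟩
      rw [div_le_one (by linarith)]; exact h2
    · fin_cases k <;> simp at hk ⊢
      · left; exact hk
      · left; exact hk
      · field_simp; linarith
    · simp; field_simp; ring
    · simp; field_simp
    · simp; field_simp; ring

namespace HexChamber

/-- Twice the coordinates of the corners. -/
def dbl (c : HexChamber) : Fin 3 → ℤ × ℤ :=
  ![(2 * c.v.1, 2 * c.v.2), (c.v.1 + c.w.1, c.v.2 + c.w.2), (2 * c.f.1, 2 * c.f.2)]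

theorem corner_eq (c : HexChamber) (i : Fin 3) :
    c.corner i = (((c.dbl i).1 : ℚ) / 2, ((c.dbl i).2 : ℚ) / 2) := by
  fin_cases i <;> simp [corner, dbl]

/-- Affine functions (of doubled coordinates) that vanish on the sides of the triangle and are
nonnegative inside. -/
def _root_.gcWall (l m : ℕ) (k : Fin 3) (p : ℤ × ℤ) : ℤ :=
  if m = 0 then ![p.1 - p.2, p.2, 2 * l - (p.1 + p.2)] k
  else ![p.1, p.2 - p.1, 6 * l - (p.1 + 2 * p.2)] k

theorem corner_mem_triangle {l m : ℕ} (hl : 0 < l) (h : l = m ∨ m = 0) (c : HexChamber)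
    (i : Fin 3) : c.corner i ∈ gcTriangle l m ↔ ∀ k, 0 ≤ gcWall l m k (c.dbl i) := by
  rw [corner_eq]
  generalize (c.dbl i) = p
  obtain ⟨a, b⟩ := p
  simp only [Fin.forall_fin_succ, ← Int.cast_nonneg_iff (R := ℚ)]
  rcases h with rfl | rfl
  · rw [mem_gcTriangle_self hl]
    simp [gcWall, hl.ne', -Int.cast_nonneg_iff, -sub_nonneg]
    constructor <;> rintro ⟨h0, h1, h2⟩ <;> refine ⟨?_, ?_, ?_⟩ <;> linarith
  · rw [mem_gcTriangle_zero hl]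
    simp [gcWall, -Int.cast_nonneg_iff, -sub_nonneg]
    constructor <;> rintro ⟨h0, h1, h2⟩ <;> refine ⟨?_, ?_, ?_⟩ <;> linarith

theorem corner_mem_side {l m : ℕ} (hl : 0 < l) (h : l = m ∨ m = 0) (c : HexChamber)
    (i k : Fin 3) : c.corner i ∈ gcSide l m k ↔
      c.corner i ∈ gcTriangle l m ∧ gcWall l m k (c.dbl i) = 0 := by
  rw [corner_eq]
  generalize (c.dbl i) = p
  obtain ⟨a, b⟩ := p
  rw [← Int.cast_eq_zero (α := ℚ)]
  rcases h with rfl | rfl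
  · rw [mem_gcSide_self hl, mem_gcTriangle_self hl]
    refine and_congr_right fun _ => ?_
    fin_cases k <;> simp [gcWall, hl.ne', -Int.cast_eq_zero] <;>
      constructor <;> intro h <;> linarith
  · rw [mem_gcSide_zero hl, mem_gcTriangle_zero hl]
    refine and_congr_right fun _ => ?_
    fin_cases k <;> simp [gcWall, -Int.cast_eq_zero] <;>
      constructor <;> intro h <;> linarith

/-- The possible shapes of a chamber. -/
theorem shape (c : HexChamber) : ∃ t a b a' b' : ℤ, c.f.1 = c.f.2 + 3 * t ∧
    c.v.1 = c.f.1 + a ∧ c.v.2 = c.f.2 + b ∧ c.w.1 = c.f.1 + a' ∧ c.w.2 = c.f.2 + b' ∧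
    ((a = 1 ∧ b = 0 ∧ a' = 0 ∧ b' = 1) ∨ (a = 0 ∧ b = 1 ∧ a' = -1 ∧ b' = 1) ∨
     (a = -1 ∧ b = 1 ∧ a' = -1 ∧ b' = 0) ∨ (a = -1 ∧ b = 0 ∧ a' = 0 ∧ b' = -1) ∨
     (a = 0 ∧ b = -1 ∧ a' = 1 ∧ b' = -1) ∨ (a = 1 ∧ b = -1 ∧ a' = 1 ∧ b' = 0) ∨
     (a' = 1 ∧ b' = 0 ∧ a = 0 ∧ b = 1) ∨ (a' = 0 ∧ b' = 1 ∧ a = -1 ∧ b = 1) ∨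
     (a' = -1 ∧ b' = 1 ∧ a = -1 ∧ b = 0) ∨ (a' = -1 ∧ b' = 0 ∧ a = 0 ∧ b = -1) ∨
     (a' = 0 ∧ b' = -1 ∧ a = 1 ∧ b = -1) ∨ (a' = 1 ∧ b' = -1 ∧ a = 1 ∧ b = 0)) := by
  have h1 := hexNorm_eq_one c.norm_v
  have h2 := hexNorm_eq_one c.norm_w
  have h3 := hexNorm_eq_one c.norm_edge
  obtain ⟨t, ht⟩ := c.face_center
  simp only [Prod.fst_sub, Prod.snd_sub] at h1 h2 h3
  refine ⟨t, c.v.1 - c.f.1, c.v.2 - c.f.2, c.w.1 - c.f.1, c.w.2 - c.f.2, by omega, by omega,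
    by omega, by omega, by omega, ?_⟩
  have e1 : c.v.1 - c.w.1 = (c.v.1 - c.f.1) - (c.w.1 - c.f.1) := by ring
  have e2 : c.v.2 - c.w.2 = (c.v.2 - c.f.2) - (c.w.2 - c.f.2) := by ring
  rw [e1, e2] at h3
  generalize c.v.1 - c.f.1 = a at *
  generalize c.v.2 - c.f.2 = b at *
  generalize c.w.1 - c.f.1 = a' at *
  generalize c.w.2 - c.f.2 = b' at *
  clear ht e1 e2
  rcases h1 with ⟨rfl, rfl⟩ | ⟨rfl, rfl⟩ | ⟨rfl, rfl⟩ | ⟨rfl, rfl⟩ | ⟨rfl, rfl⟩ | ⟨rfl, rfl⟩ <;>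
  rcases h2 with ⟨rfl, rfl⟩ | ⟨rfl, rfl⟩ | ⟨rfl, rfl⟩ | ⟨rfl, rfl⟩ | ⟨rfl, rfl⟩ | ⟨rfl, rfl⟩ <;>
  simp at h3 ⊢

variable {l m : ℕ} {c : HexChamber}


theorem flip_dbl (c : HexChamber) {i j : Fin 3} (h : j ≠ i) : (c.flip i).dbl j = c.dbl j := by
  fin_cases i <;> fin_cases j <;> simp [flip, dbl, add_comm] at h ⊢

theorem inTriangle_iff (hl : 0 < l) (h : l = m ∨ m = 0) :
    c.InTriangle l m ↔ ∀ j k, 0 ≤ gcWall l m k (c.dbl j) := by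
  simp only [InTriangle, corner_mem_triangle hl h]

theorem edgeOnSide_iff (hl : 0 < l) (h : l = m ∨ m = 0) (hc : c.InTriangle l m) {i k : Fin 3} :
    c.EdgeOnSide l m i k ↔ ∀ j, j ≠ i → gcWall l m k (c.dbl j) = 0 := by
  simp only [EdgeOnSide, corner_mem_side hl h]
  exact ⟨fun H j hj => (H j hj).2, fun H j hj => ⟨hc j, H j hj⟩⟩

/-- A chamber and its neighbour cannot be separated by a side of the triangle, unless their common
edge lies on this side. -/
theorem wall_flip {i k : Fin 3} (h0 : ∀ j, 0 ≤ gcWall l m k (c.dbl j))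
    (h1 : gcWall l m k ((c.flip i).dbl i) < 0) : ∀ j, j ≠ i → gcWall l m k (c.dbl j) = 0 := by
  obtain ⟨t, a, b, a', b', e0, e1, e2, e3, e4, hs⟩ := c.shape
  suffices H : gcWall l m k (c.dbl (i + 1)) = 0 ∧ gcWall l m k (c.dbl (i + 2)) = 0 by
    intro j hj
    have : j = i + 1 ∨ j = i + 2 := by clear * - hj; revert i j; decide
    rcases this with rfl | rfl
    exacts [H.1, H.2]
  have h00 := h0 0
  have h01 := h0 1
  have h02 := h0 2
  clear h0
  obtain rfl | rfl | rfl : i = 0 ∨ i = 1 ∨ i = 2 := by clear * -; revert i; decide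
  all_goals
    obtain rfl | rfl | rfl : k = 0 ∨ k = 1 ∨ k = 2 := by clear * -; revert k; decide
    all_goals
      simp only [gcWall] at *
      split_ifs at * with hm
      all_goals
        simp [dbl, flip, e1, e2, e3, e4] at h00 h01 h02 h1 ⊢
        clear e1 e2 e3 e4
        omega

theorem exists_edgeOnSide (hl : 0 < l) (h : l = m ∨ m = 0) {i : Fin 3}
    (hc : c.InTriangle l m) (hi : ¬ (c.flip i).InTriangle l m) :
    ∃ k, c.EdgeOnSide l m i k := by
  rw [inTriangle_iff hl h] at hi
  push Not at hi
  obtain ⟨j, k, hk⟩ := hi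
  refine ⟨k, (edgeOnSide_iff hl h hc).2 ?_⟩
  rw [inTriangle_iff hl h] at hc
  have hj : j = i := by
    by_contra hj
    rw [flip_dbl c hj] at hk
    exact absurd (hc j k) (not_le.2 hk)
  subst hj
  exact wall_flip (fun j => hc j k) hk

/-- No edge lies on two sides. -/
theorem wall_unique {i k k' : Fin 3}
    (h0 : ∀ j, j ≠ i → gcWall l m k (c.dbl j) = 0)
    (h1 : ∀ j, j ≠ i → gcWall l m k' (c.dbl j) = 0) : k = k' := by
  obtain ⟨t, a, b, a', b', e0, e1, e2, e3, e4, hs⟩ := c.shape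
  have a0 := h0 (i + 1) (by clear * -; revert i; decide)
  have b0 := h0 (i + 2) (by clear * -; revert i; decide)
  have a1 := h1 (i + 1) (by clear * -; revert i; decide)
  have b1 := h1 (i + 2) (by clear * -; revert i; decide)
  clear h0 h1
  obtain rfl | rfl | rfl : i = 0 ∨ i = 1 ∨ i = 2 := by clear * -; revert i; decide
  all_goals
    obtain rfl | rfl | rfl : k = 0 ∨ k = 1 ∨ k = 2 := by clear * -; revert k; decide
    all_goals
      obtain rfl | rfl | rfl : k' = 0 ∨ k' = 1 ∨ k' = 2 := by clear * -; revert k'; decide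
      all_goals
        first
        | rfl
        | exfalso
          simp only [gcWall] at *
          split_ifs at * with hm
          all_goals
            simp [dbl, e1, e2, e3, e4] at a0 b0 a1 b1
            clear e1 e2 e3 e4
            omega

theorem edgeSide_eq (hl : 0 < l) (h : l = m ∨ m = 0) {i k : Fin 3} (hc : c.InTriangle l m)
    (hk : c.EdgeOnSide l m i k) : c.edgeSide l m i = k := by
  have key : ∀ k', c.EdgeOnSide l m i k' → k' = k := fun k' hk' =>
    wall_unique ((edgeOnSide_iff hl h hc).1 hk') ((edgeOnSide_iff hl h hc).1 hk)
  unfold edgeSide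
  split_ifs with h0 h1
  · exact key _ h0
  · exact key _ h1
  · fin_cases k
    · exact absurd hk h0
    · exact absurd hk h1
    · rfl

theorem edgeOnSide_edgeSide (hl : 0 < l) (h : l = m ∨ m = 0) {i : Fin 3} (hc : c.InTriangle l m)
    (hi : ¬ (c.flip i).InTriangle l m) : c.EdgeOnSide l m i (c.edgeSide l m i) := by
  obtain ⟨k, hk⟩ := exists_edgeOnSide hl h hc hi
  rwa [edgeSide_eq hl h hc hk]

theorem flip_comm (c : HexChamber) : (c.flip 0).flip 2 = (c.flip 2).flip 0 := by
  ext <;> simp [flip, add_comm]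

theorem flip_ne (c : HexChamber) (i : Fin 3) : c.flip i ≠ c := by
  intro h
  have h' := congrArg (fun d => d.dbl i) h
  obtain ⟨t, a, b, a', b', e0, e1, e2, e3, e4, hs⟩ := c.shape
  fin_cases i <;> simp [dbl, flip, Prod.ext_iff, e1, e2, e3, e4] at h' <;> omega

theorem flip_zero_ne_flip_two (c : HexChamber) : c.flip 0 ≠ c.flip 2 := by
  intro h
  have h' := congrArg (fun d => d.dbl 2) h
  rw [flip_dbl c (by decide)] at h'
  obtain ⟨t, a, b, a', b', e0, e1, e2, e3, e4, hs⟩ := c.shape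
  simp [dbl, flip, Prod.ext_iff, e1, e2, e3, e4] at h'
  omega

/-- The other corner of the edge, and the centre of the other face at the edge, are obtained by
reflection at the midpoint of the edge. -/
theorem wall_add (l m : ℕ) (k i : Fin 3) (hi : i ≠ 1) (c : HexChamber) :
    gcWall l m k (c.dbl i) + gcWall l m k ((c.flip i).dbl i) = 2 * gcWall l m k (c.dbl 1) := by
  simp only [gcWall]
  split_ifs <;> fin_cases i <;> fin_cases k <;> simp [dbl, flip] at hi ⊢ <;> ring

theorem inTriangle_flip_flip (hl : 0 < l) (h : l = m ∨ m = 0)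
    (h0 : (c.flip 0).InTriangle l m) (h2 : (c.flip 2).InTriangle l m) :
    ((c.flip 0).flip 2).InTriangle l m := by
  rw [inTriangle_iff hl h] at *
  intro j k
  by_cases hj : j = 2
  · subst hj
    rw [flip_comm, flip_dbl _ (by decide)]
    exact h2 2 k
  · rw [flip_dbl _ hj]
    exact h0 j k

theorem edgeOnSide_flip (hl : 0 < l) (h : l = m ∨ m = 0) {i i' k : Fin 3} (hi : i ≠ 1)
    (hi' : i' ≠ 1) (hii : i ≠ i') (hc : c.InTriangle l m)
    (hf : (c.flip i').InTriangle l m) (hk : c.EdgeOnSide l m i k) :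
    (c.flip i').EdgeOnSide l m i k := by
  rw [edgeOnSide_iff hl h hc] at hk
  rw [edgeOnSide_iff hl h hf]
  intro j hj
  by_cases hj' : j = i'
  · subst hj'
    have := wall_add l m k j hi' c
    have h1 := hk 1 (Ne.symm hi)
    have h2 := hk j hj
    omega
  · rw [flip_dbl c hj']
    exact hk j hj

theorem corner_sides (hl : 0 < l) (h : l = m ∨ m = 0) {j k : Fin 3} (hc : c.InTriangle l m)
    (hj : c.EdgeOnSide l m 0 j) (hk : c.EdgeOnSide l m 2 k) :
    (j = 0 ∧ k = 2) ∨ (j = 2 ∧ k = 0) := by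
  rw [edgeOnSide_iff hl h hc] at hj hk
  obtain ⟨t, a, b, a', b', e0, e1, e2, e3, e4, hs⟩ := c.shape
  have h1 := hj 1 (by decide)
  have h2 := hj 2 (by decide)
  have h3 := hk 0 (by decide)
  have h4 := hk 1 (by decide)
  clear hj hk hc
  simp only [gcWall] at *
  split_ifs at * with hm
  · fin_cases j <;> fin_cases k <;> first | (left; exact ⟨rfl, rfl⟩) | (right; exact ⟨rfl, rfl⟩) | skip
    all_goals
      exfalso
      simp [dbl, e1, e2, e3, e4] at h1 h2 h3 h4
      clear e1 e2 e3 e4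
      omega
  · fin_cases j <;> fin_cases k <;> first | (left; exact ⟨rfl, rfl⟩) | (right; exact ⟨rfl, rfl⟩) | skip
    all_goals
      exfalso
      simp [dbl, e1, e2, e3, e4] at h1 h2 h3 h4
      clear e1 e2 e3 e4
      omega

theorem finite_inTriangle (hl : 0 < l) (h : l = m ∨ m = 0) :
    Finite {c : HexChamber // c.InTriangle l m} := by
  let B : Set ℤ := Set.Icc (-(6 * l + 6 : ℤ)) (6 * l + 6)
  have key : ∀ (c : HexChamber) (i : Fin 3), c.InTriangle l m →
      (c.dbl i).1 ∈ B ∧ (c.dbl i).2 ∈ B := by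
    intro c i hc
    rw [inTriangle_iff hl h] at hc
    have h0 := hc i 0
    have h1 := hc i 1
    have h2 := hc i 2
    simp only [gcWall] at h0 h1 h2
    simp only [B, Set.mem_Icc]
    split_ifs at h0 h1 h2 <;> simp at h0 h1 h2 <;> omega
  let F : {c : HexChamber // c.InTriangle l m} → Fin 3 → B × B := fun c i =>
    (⟨(c.1.dbl i).1, (key c.1 i c.2).1⟩, ⟨(c.1.dbl i).2, (key c.1 i c.2).2⟩)
  refine Finite.of_injective F ?_
  rintro ⟨c, hc⟩ ⟨d, hd⟩ hcd
  have H0 := congrFun hcd 0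
  have H1 := congrFun hcd 1
  have H2 := congrFun hcd 2
  simp [F, dbl] at H0 H1 H2
  refine Subtype.ext ?_
  ext <;> simp <;> omega

end HexChamber

open Classical in
/-- The chambers adjacent to a chamber in the triangle, and the sides that it meets in an edge. -/
noncomputable def gcAdj (l m : ℕ) (i : Fin 3) (c : {c : HexChamber // c.InTriangle l m}) :
    {c : HexChamber // c.InTriangle l m} ⊕ Fin 3 :=
  if h : (c.1.flip i).InTriangle l m then .inl ⟨c.1.flip i, h⟩ else .inr (c.1.edgeSide l m i)

theorem gcAdj_eq_inl {l m : ℕ} {i : Fin 3} {c d : {c : HexChamber // c.InTriangle l m}} :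
    gcAdj l m i c = .inl d ↔ c.1.flip i = d.1 := by
  unfold gcAdj
  split_ifs with h
  · simp [Subtype.ext_iff]
  · simp only [false_iff]
    intro h'
    exact h (h' ▸ d.2)

theorem gcAdj_eq_inr {l m : ℕ} (hl : 0 < l) (h : l = m ∨ m = 0) {i k : Fin 3}
    {c : {c : HexChamber // c.InTriangle l m}} :
    gcAdj l m i c = .inr k ↔ ¬ (c.1.flip i).InTriangle l m ∧ c.1.EdgeOnSide l m i k := by
  unfold gcAdj
  split_ifs with h'
  · simp [h']
  · simp only [Sum.inr.injEq, h', not_false_eq_true, true_and]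
    exact ⟨fun e => e ▸ HexChamber.edgeOnSide_edgeSide hl h c.2 h',
      HexChamber.edgeSide_eq hl h c.2⟩

open HexChamber in
/-- The Goldberg–Coxeter operation `GC(l, m)` with `l = m` or `m = 0`: the triangle with corners
`v₀ = (l, m)`, `v₁ = ((l - m) / 2, (l + 2 m) / 2)` and `v₂ = (0, 0)` that is cut out of the
barycentric subdivision of the hexagonal tiling. -/
noncomputable def goldbergCoxeter (l m : ℕ) (hl : 0 < l) (h : l = m ∨ m = 0) : LocalOperation where
  Chamber := {c : HexChamber // c.InTriangle l m}
  finite_chamber := finite_inTriangle hl h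
  adj := gcAdj l m
  adj_symm i c d hd := by
    rw [gcAdj_eq_inl] at *
    rw [← hd, HexChamber.flip_flip]
  adj_ne i c hc := flip_ne _ _ (gcAdj_eq_inl.1 hc)
  adj_inner c a b ha hb := by
    rw [gcAdj_eq_inl] at ha hb
    refine ⟨fun hab => flip_zero_ne_flip_two c.1 (by rw [ha, hb, hab]),
      ⟨(c.1.flip 0).flip 2, inTriangle_flip_flip hl h (ha ▸ a.2) (hb ▸ b.2)⟩, ?_, ?_⟩
    · rw [gcAdj_eq_inl]
      exact congrArg (HexChamber.flip 2) ha.symm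
    · rw [gcAdj_eq_inl]
      exact (congrArg (HexChamber.flip 0) hb.symm).trans (flip_comm c.1).symm
  adj_bdry_two c a k ha hk := by
    rw [gcAdj_eq_inl] at ha
    rw [gcAdj_eq_inr hl h] at hk ⊢
    rw [← ha]
    have ha' : (c.1.flip 0).InTriangle l m := ha ▸ a.2
    refine ⟨fun hd => hk.1 ?_, edgeOnSide_flip hl h (by decide) (by decide) (by decide) c.2
      ha' hk.2⟩
    rw [inTriangle_iff hl h] at hd ⊢
    have hc := (inTriangle_iff hl h).1 c.2
    intro j n
    by_cases hj : j = 2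
    · subst hj
      have := hd 2 n
      rwa [flip_comm, flip_dbl _ (by decide)] at this
    · rw [flip_dbl _ hj]
      exact hc j n
  adj_bdry_zero c b k hk hb := by
    rw [gcAdj_eq_inl] at hb
    rw [gcAdj_eq_inr hl h] at hk ⊢
    rw [← hb]
    have hb' : (c.1.flip 2).InTriangle l m := hb ▸ b.2
    refine ⟨fun hd => hk.1 ?_, edgeOnSide_flip hl h (by decide) (by decide) (by decide) c.2
      hb' hk.2⟩
    rw [inTriangle_iff hl h] at hd ⊢
    have hc := (inTriangle_iff hl h).1 c.2
    intro j n
    by_cases hj : j = 0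
    · subst hj
      have := hd 0 n
      rwa [← flip_comm, flip_dbl _ (by decide)] at this
    · rw [flip_dbl _ hj]
      exact hc j n
  adj_corner c j k hj hk := by
    rw [gcAdj_eq_inr hl h] at hj hk
    exact corner_sides hl h c.2 hj.2 hk.2

/-! Euler's formula on the torus, together with hexagonal faces and vertex degrees at least three
(3-connectivity), forces every vertex of `P` to have degree three (`period_vertex`). Hence the
chambers of `P` satisfy the Coxeter relations of the hexagonal tiling, and the tiling covers `P` by
a map `π` (`IsHexagonal.exists_covering`). Two chambers with the same image under `π` differ by a
translation that leaves `π` invariant (`IsCovering.exists_translate`): orientability excludes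
reversing isometries, and a rotation would map a cell of the tiling to a cell of `P` with too few
chambers.

The triangles cut out by `GC(l, m)`, one for each chamber of the tiling scaled by `gcScale`, again
form the tiling (`gcMap_bijective`). So the tiling also covers `O(P)`, and the fibres there are
orbits of scaled translations. All translations commute, so every translation of the unscaled tiling
descends to an automorphism of `O(P)`, in particular the one by `(1, 1)` (`IsCovering.exists_aut`).

`Aut(P)` embeds in `Aut(O(P))` by permuting the copies of the triangle, without changing the
position of a chamber in its copy. If the symmetry did not increase, the translation by `(1, 1)`
would be of this kind. It would then carry a chamber at a corner `v₂` to a chamber at a corner `v₂`,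
so `(1, 1)` would be the scaled image of a face centre, which happens only for the identity
operation (`gcScale_ne`). -/

/-! ### Counting chambers around cells; all vertices have degree three. -/

namespace SurfaceMap

variable {P : SurfaceMap.{u}}

open Function

/-- Walk around the cell of colour `k ≠ i, j`. -/
def spin (P : SurfaceMap.{u}) (i j : Fin 3) : P.Chamber → P.Chamber := P.r i ∘ P.r j

theorem r_injective (i : Fin 3) : Injective (P.r i) :=
  (show Involutive (P.r i) from P.r_r i).injective

theorem spin_injective (i j : Fin 3) : Injective (P.spin i j) :=
  (r_injective i).comp (r_injective j)

theorem spin_period_pos (i j : Fin 3) (C : P.Chamber) : 0 < minimalPeriod (P.spin i j) C := by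
  have := P.finite_chamber
  exact minimalPeriod_pos_of_mem_periodicPts ((spin_injective i j).mem_periodicPts C)

theorem cell_r {i k : Fin 3} (h : i ≠ k) (C : P.Chamber) : P.cell k (P.r i C) = P.cell k C :=
  (Quot.sound ⟨i, h, rfl⟩ : P.cell k C = P.cell k (P.r i C)).symm

theorem cell_spin {i j k : Fin 3} (hi : i ≠ k) (hj : j ≠ k) (C : P.Chamber) (a : ℕ) :
    P.cell k ((P.spin i j)^[a] C) = P.cell k C := by
  induction a with
  | zero => rfl
  | succ a ih => rw [iterate_succ_apply', spin, comp_apply, cell_r hi, cell_r hj, ← spin, ih]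

/-- A property that is invariant under the two adjacencies that preserve a cell is constant on the
cell. -/
theorem of_cell_eq {k : Fin 3} {Z : P.Chamber → Prop}
    (hZ : ∀ j, j ≠ k → ∀ C, Z C → Z (P.r j C)) {C D : P.Chamber} (h : P.cell k C = P.cell k D)
    (hC : Z C) : Z D := by
  let F : P.Cell k → Prop := Quot.lift Z (by
    rintro A _ ⟨j, hj, rfl⟩
    refine propext ⟨hZ j hj A, fun h => ?_⟩
    rw [← P.r_r j A]
    exact hZ j hj _ h)
  exact (congrArg F h).mp hC

/-- The chambers listed on the right are closed under both involutions `r i` and `r j`, which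
generate the cell; this is the orbit of a dihedral group. -/
theorem exists_spin_eq {i j k : Fin 3} (hij : ∀ x, x ≠ k → x = i ∨ x = j) {C D : P.Chamber}
    (h : P.cell k C = P.cell k D) :
    ∃ a, a < minimalPeriod (P.spin i j) C ∧
      (D = (P.spin i j)^[a] C ∨ D = P.r j ((P.spin i j)^[a] C)) := by
  suffices H : ∃ a, D = (P.spin i j)^[a] C ∨ D = P.r j ((P.spin i j)^[a] C) by
    obtain ⟨a, ha⟩ := H
    refine ⟨a % minimalPeriod (P.spin i j) C, Nat.mod_lt _ (spin_period_pos i j C), ?_⟩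
    rwa [iterate_mod_minimalPeriod_eq]
  refine of_cell_eq (Z := fun D => ∃ a, D = (P.spin i j)^[a] C ∨ D = P.r j ((P.spin i j)^[a] C))
    ?_ h ⟨0, Or.inl rfl⟩
  intro x hx D hD
  obtain ⟨a, ha⟩ := hD
  rcases hij x hx with rfl | rfl
  · rcases ha with rfl | rfl
    · obtain ⟨b, hb⟩ : ∃ b, (P.spin x j)^[a] C = P.spin x j ((P.spin x j)^[b] C) := by
        -- This is `a - 1` modulo the period, written without a subtraction that could truncate at
        -- `a = 0`.
        refine ⟨a + (minimalPeriod (P.spin x j) C - 1), ?_⟩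
        have := spin_period_pos x j C
        rw [← iterate_succ_apply' (P.spin x j),
          show (a + (minimalPeriod (P.spin x j) C - 1)).succ
            = a + minimalPeriod (P.spin x j) C by omega, iterate_add_minimalPeriod_eq]
      refine ⟨b, Or.inr ?_⟩
      rw [hb, spin, comp_apply, P.r_r]
    · exact ⟨a + 1, Or.inl (by rw [iterate_succ_apply', spin, comp_apply])⟩
  · rcases ha with rfl | rfl
    · exact ⟨a, Or.inr rfl⟩
    · exact ⟨a, Or.inl (P.r_r _ _)⟩

/-- In an orientable map, a cell consists of the two orbits of the rotation around it. -/
theorem card_cell (ho : P.IsOrientable) {i j k : Fin 3} (hi : i ≠ k) (hj : j ≠ k)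
    (hij : ∀ x, x ≠ k → x = i ∨ x = j) (C : P.Chamber) :
    Nat.card {D : P.Chamber // P.cell k D = P.cell k C} =
      2 * minimalPeriod (P.spin i j) C := by
  obtain ⟨o, ho⟩ := ho
  -- A rotation is a product of two adjacencies and preserves the orientation, so the orbit of `C`
  -- and its mirror orbit are disjoint.
  have hos : ∀ a, o ((P.spin i j)^[a] C) = o C := by
    intro a
    induction a with
    | zero => rfl
    | succ a ih => rw [iterate_succ_apply', spin, comp_apply, ho, ho, ← spin, ih, Bool.not_not]
  have hinj := iterate_injOn_Iio_minimalPeriod (f := P.spin i j) (x := C)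
  let φ : Bool × Fin (minimalPeriod (P.spin i j) C) →
      {D : P.Chamber // P.cell k D = P.cell k C} := fun x =>
    ⟨cond x.1 ((P.spin i j)^[x.2] C) (P.r j ((P.spin i j)^[x.2] C)), by
      rcases x with ⟨_ | _, a⟩
      · exact (cell_r hj _).trans (cell_spin hi hj C a)
      · exact cell_spin hi hj C a⟩
  have hφ : Bijective φ := by
    constructor
    · rintro ⟨s, a⟩ ⟨t, b⟩ h
      have h := congrArg Subtype.val h
      cases s <;> cases t <;> simp only [φ, cond_true, cond_false] at h
      · rw [Fin.ext (hinj a.2 b.2 (r_injective j h))]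
      · have := congrArg o h
        rw [ho, hos, hos] at this
        cases h : o C <;> simp [h] at this
      · have := congrArg o h
        rw [ho, hos, hos] at this
        cases h : o C <;> simp [h] at this
      · rw [Fin.ext (hinj a.2 b.2 h)]
    · rintro ⟨D, hD⟩
      obtain ⟨a, ha, h | h⟩ := exists_spin_eq hij hD.symm
      · exact ⟨(true, ⟨a, ha⟩), Subtype.ext h.symm⟩
      · exact ⟨(false, ⟨a, ha⟩), Subtype.ext h.symm⟩
  rw [← Nat.card_eq_of_bijective φ hφ]
  simp

theorem period_edge (C : P.Chamber) : minimalPeriod (P.spin 0 2) C = 2 := by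
  refine minimalPeriod_eq_prime (p := 2) ?_ ?_
  · show P.r 0 (P.r 2 (P.r 0 (P.r 2 C))) = C
    rw [P.r_comm, P.r_r, P.r_r]
  · intro h
    apply P.r_zero_ne_r_two C
    have h : P.r 0 (P.r 2 C) = C := h
    conv_lhs => rw [← h]
    rw [P.r_r]

/-- The chambers are counted by the cells of any colour. -/
theorem sum_card_cell (P : SurfaceMap.{u}) (k : Fin 3) [Fintype (P.Cell k)] :
    ∑ x : P.Cell k, Nat.card {D : P.Chamber // P.cell k D = x} = Nat.card P.Chamber := by
  have := P.finite_chamber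
  rw [← Nat.card_sigma]
  exact Nat.card_congr (Equiv.sigmaFiberEquiv (P.cell k))

theorem cell_surjective (k : Fin 3) : Surjective (P.cell k) := Quot.mk_surjective

theorem finite_cell (k : Fin 3) : Finite (P.Cell k) :=
  have := P.finite_chamber
  Finite.of_surjective _ (cell_surjective (P := P) k)

theorem card_face_of_size (ho : P.IsOrientable) {n : ℕ} {C : P.Chamber}
    (h : P.faceSize (P.cell 2 C) = n) : minimalPeriod (P.spin 0 1) C = n := by
  rw [faceSize, card_cell ho (i := 0) (j := 1) (by decide) (by decide) (by decide)] at h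
  omega

/-- In a map with 3-connected graph, every vertex has degree at least three. -/
theorem three_le_period (h3 : P.graph.IsThreeConnected) (C : P.Chamber) :
    3 ≤ minimalPeriod (P.spin 1 2) C := by
  classical
  by_contra! hlt
  set n := minimalPeriod (P.spin 1 2) C
  have := finite_cell (P := P) 0
  -- All neighbours of the vertex. The vertex itself is erased, since a loop would put it into the
  -- image, and it must survive the removal of `S`.
  let S : Finset P.Vertex := ((Finset.range n).image
    fun a => P.cell 0 (P.r 0 ((P.spin 1 2)^[a] C))).erase (P.cell 0 C)
  have hS : S.card ≤ 2 := by
    refine (Finset.card_erase_le.trans Finset.card_image_le).trans ?_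
    rw [Finset.card_range]
    omega
  have hnb : ∀ y, P.graph.Adj (P.cell 0 C) y → y ∈ S := by
    rintro y ⟨hy, D, hD, rfl⟩
    refine Finset.mem_erase.2 ⟨hy.symm, Finset.mem_image.2 ?_⟩
    obtain ⟨a, ha, rfl | rfl⟩ := exists_spin_eq (i := 1) (j := 2) (by decide) hD.symm
    · exact ⟨a, Finset.mem_range.2 ha, rfl⟩
    · exact ⟨a, Finset.mem_range.2 ha, by rw [P.r_comm, cell_r (i := 2) (by decide)]⟩
  have hconn := h3.2 S hS
  -- At least `4 - 2` vertices remain, so connectedness would give the vertex a neighbour outside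
  -- `S`.
  have hcard : 1 < Nat.card {x : P.Vertex | x ∉ S} := by
    have h4 := h3.1
    have hsum := Set.ncard_add_ncard_compl (S : Set P.Vertex)
    rw [Set.ncard_coe_finset] at hsum
    have : Nat.card {x : P.Vertex | x ∉ S} = ((S : Set P.Vertex)ᶜ).ncard := rfl
    omega
  have hmem : P.cell 0 C ∉ S := Finset.notMem_erase _ _
  have : Nontrivial {x : P.Vertex | x ∉ S} := (Finite.one_lt_card_iff_nontrivial).1 hcard
  obtain ⟨y, hy⟩ := hconn.preconnected.exists_adj_of_nontrivial ⟨P.cell 0 C, hmem⟩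
  exact y.2 (hnb _ hy)

/-- In a toroidal map with 3-connected graph and all faces of size 6, all vertices have
degree 3. -/
theorem period_vertex (hg : P.HasGenus 1) (h3 : P.graph.IsThreeConnected)
    (h6 : ∀ f : P.Face, P.faceSize f = 6) (C : P.Chamber) :
    minimalPeriod (P.spin 1 2) C = 3 := by
  classical
  obtain ⟨-, ho, hχ⟩ := hg
  have := fun k => finite_cell (P := P) k
  have := fun k => Fintype.ofFinite (P.Cell k)
  have hf : Nat.card P.Chamber = 12 * Nat.card P.Face := by
    rw [← P.sum_card_cell 2, Finset.sum_congr rfl (g := fun _ => 12)]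
    · simp [mul_comm]
    · rintro x -
      obtain ⟨D, rfl⟩ := cell_surjective 2 x
      rw [card_cell ho (i := 0) (j := 1) (by decide) (by decide) (by decide),
        card_face_of_size ho (h6 _)]
  have he : Nat.card P.Chamber = 4 * Nat.card P.Edge := by
    rw [← P.sum_card_cell 1, Finset.sum_congr rfl (g := fun _ => 4)]
    · simp [mul_comm]
    · rintro x -
      obtain ⟨D, rfl⟩ := cell_surjective 1 x
      rw [card_cell ho (i := 0) (j := 2) (by decide) (by decide) (by decide), period_edge]
  have hle : ∀ x : P.Vertex, 6 ≤ Nat.card {D : P.Chamber // P.cell 0 D = x} := by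
    intro x
    obtain ⟨D, rfl⟩ := cell_surjective 0 x
    rw [card_cell ho (i := 1) (j := 2) (by decide) (by decide) (by decide)]
    have := three_le_period h3 D
    omega
  -- With `N` chambers, `V = E - F = N / 4 - N / 12 = N / 6`. A vertex has six chambers on average
  -- and at least six in any case, hence exactly six.
  have hv : Nat.card P.Chamber = 6 * Nat.card P.Vertex := by omega
  have hsum : ∑ x : P.Vertex, 6 = ∑ x : P.Vertex, Nat.card {D : P.Chamber // P.cell 0 D = x} := by
    rw [P.sum_card_cell 0, hv]
    simp [mul_comm]
  have := (Finset.sum_eq_sum_iff_of_le fun x _ => hle x).1 hsum (P.cell 0 C) (Finset.mem_univ _)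
  rw [card_cell ho (i := 1) (j := 2) (by decide) (by decide) (by decide)] at this
  omega

end SurfaceMap

/-! ### Isometries of the hexagonal tiling -/

/-- Two unit vectors at an angle of 60 degrees. -/
structure HexFrame where
  a : ℤ × ℤ
  b : ℤ × ℤ
  norm_a : hexNorm a = 1
  norm_b : hexNorm b = 1
  norm_sub : hexNorm (a - b) = 1

namespace HexFrame

/-- One frame for each element of the dihedral group of order twelve: the first six are direct, the
last six reversed. The finite list reduces many facts about frames to linear arithmetic. -/
theorem shape (g : HexFrame) :
    (g.a = (1, 0) ∧ g.b = (0, 1)) ∨ (g.a = (0, 1) ∧ g.b = (-1, 1)) ∨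
    (g.a = (-1, 1) ∧ g.b = (-1, 0)) ∨ (g.a = (-1, 0) ∧ g.b = (0, -1)) ∨
    (g.a = (0, -1) ∧ g.b = (1, -1)) ∨ (g.a = (1, -1) ∧ g.b = (1, 0)) ∨
    (g.a = (0, 1) ∧ g.b = (1, 0)) ∨ (g.a = (-1, 1) ∧ g.b = (0, 1)) ∨
    (g.a = (-1, 0) ∧ g.b = (-1, 1)) ∨ (g.a = (0, -1) ∧ g.b = (-1, 0)) ∨
    (g.a = (1, -1) ∧ g.b = (0, -1)) ∨ (g.a = (1, 0) ∧ g.b = (1, -1)) := by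
  have h1 := HexChamber.hexNorm_eq_one g.norm_a
  have h2 := HexChamber.hexNorm_eq_one g.norm_b
  have h3 := g.norm_sub
  generalize g.a = a at *
  generalize g.b = b at *
  obtain ⟨a1, a2⟩ := a
  obtain ⟨b1, b2⟩ := b
  simp only at h1 h2
  rcases h1 with ⟨rfl, rfl⟩ | ⟨rfl, rfl⟩ | ⟨rfl, rfl⟩ | ⟨rfl, rfl⟩ | ⟨rfl, rfl⟩ | ⟨rfl, rfl⟩ <;>
  rcases h2 with ⟨rfl, rfl⟩ | ⟨rfl, rfl⟩ | ⟨rfl, rfl⟩ | ⟨rfl, rfl⟩ | ⟨rfl, rfl⟩ | ⟨rfl, rfl⟩ <;>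
  simp [hexNorm] at h3 ⊢

/-- The linear isometry that maps the basis vectors to the vectors of the frame. -/
def lin (g : HexFrame) (p : ℤ × ℤ) : ℤ × ℤ :=
  (p.1 * g.a.1 + p.2 * g.b.1, p.1 * g.a.2 + p.2 * g.b.2)

theorem lin_sub (g : HexFrame) (p q : ℤ × ℤ) : g.lin (p - q) = g.lin p - g.lin q := by
  ext <;> simp [lin] <;> ring

theorem lin_add (g : HexFrame) (p q : ℤ × ℤ) : g.lin (p + q) = g.lin p + g.lin q := by
  ext <;> simp [lin] <;> ring

/-- A binary quadratic form is determined by its values at `a`, `b` and `a - b`. -/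
theorem hexNorm_lin (g : HexFrame) (p : ℤ × ℤ) : hexNorm (g.lin p) = hexNorm p := by
  have h1 := g.norm_a
  have h2 := g.norm_b
  have h3 := g.norm_sub
  simp only [hexNorm, lin, Prod.fst_sub, Prod.snd_sub] at *
  linear_combination (p.1 ^ 2 + p.1 * p.2) * h1 + (p.2 ^ 2 + p.1 * p.2) * h2 - p.1 * p.2 * h3

theorem three_dvd_lin (g : HexFrame) {p : ℤ × ℤ} (hp : 3 ∣ p.1 - p.2) :
    3 ∣ (g.lin p).1 - (g.lin p).2 := by
  rcases g.shape with h | h | h | h | h | h | h | h | h | h | h | h <;>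
  · simp only [lin, h.1, h.2]
    omega

theorem lin_injective (g : HexFrame) : Function.Injective g.lin := by
  intro p q hpq
  simp only [lin, Prod.ext_iff] at hpq ⊢
  rcases g.shape with h | h | h | h | h | h | h | h | h | h | h | h <;>
  · simp only [h.1, h.2] at hpq
    omega

/-- The sectors of the plane of the chambers around the origin are disjoint. -/
theorem eq_of_lin_eq {g g' : HexFrame} {p p' : ℤ × ℤ} (h : g.lin p = g'.lin p')
    (hp : 0 < p.2) (hp' : 0 < p'.2) (hpp : p.2 < p.1) (hpp' : p'.2 < p'.1) :
    g.a = g'.a ∧ g.b = g'.b := by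
  simp only [lin, Prod.ext_iff] at h ⊢
  rcases g.shape with h1 | h1 | h1 | h1 | h1 | h1 | h1 | h1 | h1 | h1 | h1 | h1 <;>
  · simp only [h1.1, h1.2] at h ⊢
    rcases g'.shape with h2 | h2 | h2 | h2 | h2 | h2 | h2 | h2 | h2 | h2 | h2 | h2 <;>
    · simp only [h2.1, h2.2] at h ⊢
      first
      | (exfalso; omega)
      | simp

/-- The twelve images of the triangle for `m = 0` fill a hexagon around the origin, which is the
intersection of these three strips. -/
theorem lin_bound {g : HexFrame} {p : ℤ × ℤ} {M : ℤ} (h0 : 0 < p.2) (h1 : p.2 < p.1)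
    (h2 : p.1 + p.2 < M) :
    |(g.lin p).1| < M ∧ |(g.lin p).2| < M ∧ |(g.lin p).1 + (g.lin p).2| < M := by
  simp only [abs_lt, lin]
  rcases g.shape with h | h | h | h | h | h | h | h | h | h | h | h <;>
  · simp only [h.1, h.2]
    omega

/-- The analogue for `l = m`, where the hexagon is turned by 30 degrees. -/
theorem lin_bound' {g : HexFrame} {p : ℤ × ℤ} {M : ℤ} (h0 : 0 < p.1) (h1 : p.1 < p.2)
    (h2 : p.1 + 2 * p.2 < M) :
    |2 * (g.lin p).1 + (g.lin p).2| < M ∧ |(g.lin p).1 + 2 * (g.lin p).2| < M ∧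
      |(g.lin p).1 - (g.lin p).2| < M := by
  simp only [abs_lt, lin]
  rcases g.shape with h | h | h | h | h | h | h | h | h | h | h | h <;>
  · simp only [h.1, h.2]
    omega

/-- The image of a chamber under an isometry. -/
def app (g : HexFrame) (t : ℤ × ℤ) (ht : 3 ∣ t.1 - t.2) (c : HexChamber) : HexChamber where
  f := t + g.lin c.f
  v := t + g.lin c.v
  w := t + g.lin c.w
  face_center := by
    have := g.three_dvd_lin c.face_center
    simp only [Prod.fst_add, Prod.snd_add]
    omega
  norm_v := by rw [add_sub_add_left_eq_sub, ← lin_sub, hexNorm_lin, c.norm_v]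
  norm_w := by rw [add_sub_add_left_eq_sub, ← lin_sub, hexNorm_lin, c.norm_w]
  norm_edge := by rw [add_sub_add_left_eq_sub, ← lin_sub, hexNorm_lin, c.norm_edge]

theorem app_flip (g : HexFrame) (t : ℤ × ℤ) (ht : 3 ∣ t.1 - t.2) (i : Fin 3) (c : HexChamber) :
    g.app t ht (c.flip i) = (g.app t ht c).flip i := by
  fin_cases i <;> ext <;> simp [app, HexChamber.flip, lin] <;> ring

theorem app_injective (g : HexFrame) (t : ℤ × ℤ) (ht : 3 ∣ t.1 - t.2) :
    Function.Injective (g.app t ht) := by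
  intro c d h
  have hi := g.lin_injective
  exact HexChamber.ext (hi (add_left_cancel (congrArg HexChamber.f h)))
    (hi (add_left_cancel (congrArg HexChamber.v h)))
    (hi (add_left_cancel (congrArg HexChamber.w h)))

end HexFrame

namespace HexChamber

/-- The frame of the vectors from the face of a chamber to the ends of its edge. -/
def frame (D : HexChamber) : HexFrame where
  a := D.v - D.f
  b := D.w - D.f
  norm_a := D.norm_v
  norm_b := D.norm_w
  norm_sub := by rw [sub_sub_sub_cancel_right, D.norm_edge]

theorem ext_frame {D D' : HexChamber} (hf : D.f = D'.f) (ha : D.frame.a = D'.frame.a)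
    (hb : D.frame.b = D'.frame.b) : D = D' := by
  refine HexChamber.ext hf ?_ ?_
  · simpa [frame, hf] using ha
  · simpa [frame, hf] using hb

/-- A chamber at each face. The centre of the face has coordinates `x, y` with respect to the basis
`(1, 1), (-1, 2)` of the lattice of the centres. -/
def std (x y : ℤ) : HexChamber where
  f := (x - y, x + 2 * y)
  v := (x - y + 1, x + 2 * y)
  w := (x - y, x + 2 * y + 1)
  face_center := ⟨-y, by ring⟩
  norm_v := by simp [hexNorm]
  norm_w := by simp [hexNorm]
  norm_edge := by simp [hexNorm]

/-- Alternately flip the colours `0` and `1`. -/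
def turn (c : HexChamber) : ℕ → HexChamber
  | 0 => c
  | n + 1 => (c.turn n).flip (if n % 2 = 0 then 0 else 1)

theorem exists_turn_std (c : HexChamber) : ∃ x y n, c = (std x y).turn n := by
  obtain ⟨t, a, b, a', b', e0, e1, e2, e3, e4, hs⟩ := c.shape
  -- The solution of `x - y = c.f.1`, `x + 2 * y = c.f.2`. Even numbers of turns give the direct
  -- chambers of the face, odd numbers the reversed ones.
  refine ⟨c.f.1 - t, -t, ?_⟩
  have hfr : c.f.1 = c.f.1 - t - -t ∧ c.f.2 = c.f.1 - t + 2 * -t := by omega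
  rcases hs with h | h | h | h | h | h | h | h | h | h | h | h
  · exact ⟨0, by ext <;> simp [turn, std] <;> omega⟩
  · exact ⟨2, by ext <;> simp [turn, std, flip] <;> omega⟩
  · exact ⟨4, by ext <;> simp [turn, std, flip] <;> omega⟩
  · exact ⟨6, by ext <;> simp [turn, std, flip] <;> omega⟩
  · exact ⟨8, by ext <;> simp [turn, std, flip] <;> omega⟩
  · exact ⟨10, by ext <;> simp [turn, std, flip] <;> omega⟩
  · exact ⟨1, by ext <;> simp [turn, std, flip] <;> omega⟩
  · exact ⟨3, by ext <;> simp [turn, std, flip] <;> omega⟩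
  · exact ⟨5, by ext <;> simp [turn, std, flip] <;> omega⟩
  · exact ⟨7, by ext <;> simp [turn, std, flip] <;> omega⟩
  · exact ⟨9, by ext <;> simp [turn, std, flip] <;> omega⟩
  · exact ⟨11, by ext <;> simp [turn, std, flip] <;> omega⟩

/-- The tiling is connected. -/
theorem flip_induction {Z : HexChamber → Prop} (hZ : ∀ i c, Z c → Z (c.flip i)) {c : HexChamber}
    (hc : Z c) (d : HexChamber) : Z d := by
  have H : ∀ i c, Z (c.flip i) ↔ Z c := fun i c =>
    ⟨fun h => by rw [← c.flip_flip i]; exact hZ i _ h, hZ i c⟩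
  have Hturn : ∀ c n, Z (turn c n) ↔ Z c := by
    intro c n
    induction n with
    | zero => rfl
    | succ n ih => rw [turn, H, ih]
  -- Crossing the edge in direction `(1, 1)` leads to the face with `x + 1`; below, two turns before
  -- crossing give direction `(-1, 2)` and the face with `y + 1`.
  have hx : ∀ x y, Z (std (x + 1) y) ↔ Z (std x y) := by
    intro x y
    rw [← H 2 (std x y)]
    have : ((std x y).flip 2) = (std (x + 1) y).turn 7 := by
      ext <;> simp [turn, std, flip] <;> ring
    rw [this, Hturn]
  have hy : ∀ x y, Z (std x (y + 1)) ↔ Z (std x y) := by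
    intro x y
    rw [← Hturn (std x y) 2, ← H 2 (turn _ 2)]
    have : (((std x y).turn 2).flip 2) = (std x (y + 1)).turn 9 := by
      ext <;> simp [turn, std, flip] <;> ring
    rw [this, Hturn]
  have hstd : ∀ x y, Z (std x y) ↔ Z (std 0 0) := by
    intro x y
    have h1 : Z (std x y) ↔ Z (std 0 y) := by
      induction x with
      | zero => rfl
      | succ i ih => rw [hx, ih]
      | pred i ih => rw [← hx, sub_add_cancel, ih]
    rw [h1]
    clear h1
    induction y with
    | zero => rfl
    | succ i ih => exact (hy 0 i).trans ih
    | pred i ih => rwa [← hy, sub_add_cancel]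
  obtain ⟨x, y, n, rfl⟩ := exists_turn_std c
  obtain ⟨x', y', n', rfl⟩ := exists_turn_std d
  rw [Hturn, hstd] at hc ⊢
  exact hc

/-- A frame maps the standard chamber at the origin to the chamber of the frame. -/
theorem frame_app_std (D : HexChamber) : D.frame.app D.f D.face_center (std 0 0) = D := by
  ext <;> simp [HexFrame.app, frame, std, HexFrame.lin]

end HexChamber

/-! ### The tiling as the result of the Goldberg–Coxeter operation applied to the tiling -/

namespace HexFrame

/-- The orientation of the frame. -/
def det (g : HexFrame) : ℤ := g.a.1 * g.b.2 - g.a.2 * g.b.1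

/-- The rotation by 60 degrees is `(x, y) ↦ (-y, x + y)`. It takes `a` to `b` in a direct frame and
`b` to `a` in a reversed one. -/
theorem det_cases (g : HexFrame) :
    (g.det = 1 ∧ g.b.1 = -g.a.2 ∧ g.b.2 = g.a.1 + g.a.2) ∨
    (g.det = -1 ∧ g.a.1 = -g.b.2 ∧ g.a.2 = g.b.1 + g.b.2) := by
  simp only [det]
  rcases g.shape with h | h | h | h | h | h | h | h | h | h | h | h <;> simp [h.1, h.2]

/-- The image of a reversed frame under the reflection that preserves the directions `(1, 1)` and
`(0, 1)` of the sides of the triangle for `l = m`. -/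
def shift (g : HexFrame) : HexFrame where
  a := g.a - g.b
  b := g.a
  norm_a := g.norm_sub
  norm_b := g.norm_a
  norm_sub := by
    rw [← g.norm_b]
    simp only [hexNorm, Prod.fst_sub, Prod.snd_sub]
    ring

theorem det_shift (g : HexFrame) : g.shift.det = g.det := by
  simp [det, shift]
  ring

end HexFrame

/-- The similarity of the plane that maps `(1, 0)` to `(l, m)`. -/
def gcScale (l m : ℕ) (p : ℤ × ℤ) : ℤ × ℤ := (l * p.1 - m * p.2, m * p.1 + (l + m) * p.2)

theorem gcScale_add (l m : ℕ) (p q : ℤ × ℤ) :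
    gcScale l m (p + q) = gcScale l m p + gcScale l m q := by
  ext <;> simp [gcScale] <;> ring

theorem three_dvd_gcScale (l m : ℕ) {p : ℤ × ℤ} (h : 3 ∣ p.1 - p.2) :
    3 ∣ (gcScale l m p).1 - (gcScale l m p).2 := by
  obtain ⟨t, ht⟩ := h
  refine ⟨l * t - m * (t + p.2), ?_⟩
  simp only [gcScale]
  linear_combination (l - m : ℤ) * ht

/-- The reflection in the side of the triangle that is opposite to `v_k`. -/
def gcReflect (l m : ℕ) (k : Fin 3) (p : ℤ × ℤ) : ℤ × ℤ :=
  if m = 0 then ![(p.2, p.1), (p.1 + p.2, -p.2), (l - p.2, l - p.1)] k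
  else ![(-p.1, p.1 + p.2), (p.2, p.1), (p.1, 3 * l - p.1 - p.2)] k

namespace HexChamber

variable {l m : ℕ} {c : HexChamber}

-- Adjacent chambers are mirror images in the line of their common edge, and here this line is the
-- wall `k`.
set_option maxHeartbeats 2000000 in
theorem flip_eq_gcReflect {i k : Fin 3} (h : ∀ j, j ≠ i → gcWall l m k (c.dbl j) = 0) :
    (c.flip i).f = gcReflect l m k c.f ∧ (c.flip i).v = gcReflect l m k c.v ∧
      (c.flip i).w = gcReflect l m k c.w := by
  obtain ⟨t, a, b, a', b', e0, e1, e2, e3, e4, hs⟩ := c.shape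
  have h0 := h (i + 1) (by clear * -; revert i; decide)
  have h1 := h (i + 2) (by clear * -; revert i; decide)
  clear h
  obtain rfl | rfl | rfl : i = 0 ∨ i = 1 ∨ i = 2 := by clear * -; revert i; decide
  all_goals
    obtain rfl | rfl | rfl : k = 0 ∨ k = 1 ∨ k = 2 := by clear * -; revert k; decide
    all_goals
      simp only [gcWall, gcReflect] at *
      split_ifs at * with hm
      all_goals
        simp [dbl, flip, Prod.ext_iff] at h0 h1 ⊢
        omega

open Classical in
/-- The frame of the big triangle at a chamber of the scaled tiling. -/
noncomputable def gcFrame (m : ℕ) (D : HexChamber) : HexFrame :=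
  -- For `l = m` the map `gcScale` turns by 30 degrees. It commutes with rotations, but conjugating
  -- a reflection by it adds a rotation by 60 degrees, and `shift` is this rotation of a reversed
  -- frame.
  if m = 0 ∨ D.frame.det = 1 then D.frame else D.frame.shift

/-- The chamber that corresponds to the chamber `c` of the triangle in the copy of the triangle
at the chamber `D` of the scaled tiling. -/
noncomputable def gcMap (l m : ℕ) (D c : HexChamber) : HexChamber :=
  (D.gcFrame m).app (gcScale l m D.f) (three_dvd_gcScale l m D.face_center) c

theorem gcMap_flip (i : Fin 3) (D c : HexChamber) :
    gcMap l m D (c.flip i) = (gcMap l m D c).flip i :=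
  HexFrame.app_flip ..

theorem frame_flip_zero (D : HexChamber) :
    (D.flip 0).frame.a = D.frame.b ∧ (D.flip 0).frame.b = D.frame.a ∧ (D.flip 0).f = D.f :=
  ⟨rfl, rfl, rfl⟩

theorem frame_flip_one (D : HexChamber) :
    (D.flip 1).frame.a = D.frame.a ∧ (D.flip 1).frame.b = D.frame.a - D.frame.b ∧
      (D.flip 1).f = D.f := by
  simp [frame, flip]

theorem frame_flip_two (D : HexChamber) :
    (D.flip 2).frame.a = -D.frame.b ∧ (D.flip 2).frame.b = -D.frame.a ∧
      (D.flip 2).f = D.f + D.frame.a + D.frame.b := by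
  refine ⟨?_, ?_, ?_⟩ <;> simp [frame, flip] <;> abel

theorem det_flip (D : HexChamber) (k : Fin 3) : (D.flip k).frame.det = -D.frame.det := by
  fin_cases k
  · simp [HexFrame.det, D.frame_flip_zero]
    ring
  · simp [HexFrame.det, D.frame_flip_one]
    ring
  · simp [HexFrame.det, D.frame_flip_two]
    ring

/-- The triangles at adjacent chambers are mirror images. -/
theorem gcFrame_flip (hlm : l = m ∨ m = 0) (k : Fin 3) (D : HexChamber) (p : ℤ × ℤ) :
    gcScale l m (D.flip k).f + ((D.flip k).gcFrame m).lin p =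
      gcScale l m D.f + (D.gcFrame m).lin (gcReflect l m k p) := by
  by_cases hm : m = 0
  · subst hm
    simp only [gcFrame, true_or, if_true, gcScale, gcReflect]
    fin_cases k
    · simp [HexFrame.lin, D.frame_flip_zero]
      exact ⟨by ring, by ring⟩
    · simp [HexFrame.lin, D.frame_flip_one]
      exact ⟨by ring, by ring⟩
    · simp [HexFrame.lin, D.frame_flip_two]
      exact ⟨by ring, by ring⟩
  · obtain rfl : l = m := by tauto
    simp only [gcFrame, hm, false_or, if_false, gcScale, gcReflect, det_flip]
    rcases D.frame.det_cases with ⟨h, h1, h2⟩ | ⟨h, h1, h2⟩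
    · simp only [h]
      fin_cases k
      · simp [HexFrame.lin, HexFrame.shift, D.frame_flip_zero]
        exact ⟨by ring, by ring⟩
      · simp [HexFrame.lin, HexFrame.shift, D.frame_flip_one]
        exact ⟨by ring, by ring⟩
      · simp [HexFrame.lin, HexFrame.shift, D.frame_flip_two, h1, h2]
        exact ⟨by ring, by ring⟩
    · simp only [h]
      fin_cases k
      · simp [HexFrame.lin, HexFrame.shift, D.frame_flip_zero]
        exact ⟨by ring, by ring⟩
      · simp [HexFrame.lin, HexFrame.shift, D.frame_flip_one]
        exact ⟨by ring, by ring⟩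
      · simp [HexFrame.lin, HexFrame.shift, D.frame_flip_two, h1, h2]
        exact ⟨by ring, by ring⟩

/-- This is the gluing rule of `LocalOperation.glue` for boundary edges: the reflection in the side
takes the triangle at `D` to that at `D.flip k` and a chamber at the side to its neighbour. -/
theorem gcMap_flip_left (hlm : l = m ∨ m = 0) {i k : Fin 3} (D : HexChamber)
    (h : ∀ j, j ≠ i → gcWall l m k (c.dbl j) = 0) :
    gcMap l m (D.flip k) c = (gcMap l m D c).flip i := by
  rw [← gcMap_flip]
  obtain ⟨h1, h2, h3⟩ := flip_eq_gcReflect h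
  refine HexChamber.ext ?_ ?_ ?_
  · simp only [gcMap, HexFrame.app, h1, gcFrame_flip hlm]
  · simp only [gcMap, HexFrame.app, h2, gcFrame_flip hlm]
  · simp only [gcMap, HexFrame.app, h3, gcFrame_flip hlm]

/-- Six times the barycenter of a chamber. -/
def center (c : HexChamber) : ℤ × ℤ :=
  (2 * c.f.1 + 3 * c.v.1 + c.w.1, 2 * c.f.2 + 3 * c.v.2 + c.w.2)

theorem center_app (g : HexFrame) (t : ℤ × ℤ) (ht : 3 ∣ t.1 - t.2) (c : HexChamber) :
    (g.app t ht c).center = (6 * t.1, 6 * t.2) + g.lin c.center := by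
  ext <;> simp [center, HexFrame.app, HexFrame.lin] <;> ring

/-- The barycenter of a chamber in the triangle is not on the boundary of the triangle. -/
theorem wall_center_pos (hl : 0 < l) (hlm : l = m ∨ m = 0) (hc : c.InTriangle l m) (k : Fin 3) :
    0 < gcWall l m k (c.dbl 0) + gcWall l m k (c.dbl 1) + gcWall l m k (c.dbl 2) := by
  have h := fun j => (inTriangle_iff hl hlm).1 hc j k
  have h0 := h 0
  have h1 := h 1
  have h2 := h 2
  by_contra! hneg
  have H : ∀ j, gcWall l m k (c.dbl j) = 0 := by
    intro j
    fin_cases j <;> simp <;> omega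
  -- Otherwise two edges of the chamber lie on the same wall, but `corner_sides` puts them on
  -- different ones.
  rcases corner_sides hl hlm hc ((edgeOnSide_iff hl hlm hc).2 fun j _ => H j)
    ((edgeOnSide_iff hl hlm hc).2 fun j _ => H j) with ⟨rfl, h⟩ | ⟨rfl, h⟩ <;> simp at h

theorem center_bounds_zero (hl : 0 < l) (hc : c.InTriangle l 0) :
    0 < c.center.2 ∧ c.center.2 < c.center.1 ∧ c.center.1 + c.center.2 < 6 * l := by
  have h0 := wall_center_pos hl (Or.inr rfl) hc 0
  have h1 := wall_center_pos hl (Or.inr rfl) hc 1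
  have h2 := wall_center_pos hl (Or.inr rfl) hc 2
  simp [gcWall, dbl] at h0 h1 h2
  simp only [center]
  omega

theorem center_bounds_self (hl : 0 < l) (hc : c.InTriangle l l) :
    0 < c.center.1 ∧ c.center.1 < c.center.2 ∧ c.center.1 + 2 * c.center.2 < 18 * l := by
  have h0 := wall_center_pos hl (Or.inl rfl) hc 0
  have h1 := wall_center_pos hl (Or.inl rfl) hc 1
  have h2 := wall_center_pos hl (Or.inl rfl) hc 2
  simp [gcWall, dbl, hl.ne'] at h0 h1 h2
  simp only [center]
  omega

/-- A multiple of `M` of absolute value less than `2 M` is `0` or `± M`. -/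
theorem _root_.abs_le_one_of_mul {M x y z : ℤ} (hM : 0 < M) (hy : |y| < M) (hz : |z| < M)
    (h : M * x + y = z) : |x| ≤ 1 := by
  by_contra! hx
  have : M * x = z - y := by linarith
  have h1 : |M * x| < M * 2 := by
    rw [this]
    exact (abs_sub _ _).trans_lt (by linarith)
  rw [abs_mul, abs_of_pos hM] at h1
  have := lt_of_mul_lt_mul_left h1 hM.le
  omega

/-- The big triangles have disjoint interiors, and it suffices to test barycentres. A common
barycentre lies in the open big hexagons of both faces, which forces equal faces; then the
disjointness of the twelve sectors forces equal frames. -/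
theorem eq_of_gcMap_eq (hl : 0 < l) (hlm : l = m ∨ m = 0) {D D' c c' : HexChamber}
    (hc : c.InTriangle l m) (hc' : c'.InTriangle l m) (h : gcMap l m D c = gcMap l m D' c') :
    D = D' ∧ c = c' := by
  suffices H : D = D' by
    subst H
    exact ⟨rfl, HexFrame.app_injective _ _ _ h⟩
  have hl' : (0 : ℤ) < 6 * l := by positivity
  obtain ⟨t, ht⟩ := D.face_center
  obtain ⟨t', ht'⟩ := D'.face_center
  have hcen := congrArg center h
  simp only [gcMap, center_app] at hcen
  by_cases hm : m = 0
  · subst hm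
    simp only [gcFrame, true_or, if_true] at hcen
    obtain ⟨h1, h2, h3⟩ := center_bounds_zero hl hc
    obtain ⟨h1', h2', h3'⟩ := center_bounds_zero hl hc'
    obtain ⟨b1, b2, b3⟩ := HexFrame.lin_bound (g := D.frame) h1 h2 h3
    obtain ⟨b1', b2', b3'⟩ := HexFrame.lin_bound (g := D'.frame) h1' h2' h3'
    have e1 := congrArg Prod.fst hcen
    have e2 := congrArg Prod.snd hcen
    simp [gcScale] at e1 e2
    have k1 := abs_le_one_of_mul (x := D.f.1 - D'.f.1) hl' b1 b1' (by linear_combination e1)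
    have k2 := abs_le_one_of_mul (x := D.f.2 - D'.f.2) hl' b2 b2' (by linear_combination e2)
    have k3 := abs_le_one_of_mul (x := D.f.1 - D'.f.1 + (D.f.2 - D'.f.2)) hl' b3 b3'
      (by linear_combination e1 + e2)
    rw [abs_le] at k1 k2 k3
    -- The differences `x`, `y` and `x + y` lie in `{-1, 0, 1}` and `3 ∣ x - y`, so `x = y = 0`.
    have hf : D.f = D'.f := Prod.ext (by omega) (by omega)
    rw [hf] at hcen
    obtain ⟨ha, hb⟩ := HexFrame.eq_of_lin_eq (add_left_cancel hcen) h1 h1' h2 h2'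
    exact ext_frame hf ha hb
  · obtain rfl : l = m := by tauto
    have hl'' : (0 : ℤ) < 18 * l := by positivity
    obtain ⟨h1, h2, h3⟩ := center_bounds_self hl hc
    obtain ⟨h1', h2', h3'⟩ := center_bounds_self hl hc'
    obtain ⟨b1, b2, b3⟩ := HexFrame.lin_bound' (g := D.gcFrame l) h1 h2 h3
    obtain ⟨b1', b2', b3'⟩ := HexFrame.lin_bound' (g := D'.gcFrame l) h1' h2' h3'
    have e1 := congrArg Prod.fst hcen
    have e2 := congrArg Prod.snd hcen
    simp [gcScale] at e1 e2
    have k1 := abs_le_one_of_mul (x := D.f.1 - D'.f.1) hl'' b1 b1'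
      (by linear_combination 2 * e1 + e2)
    have k2 := abs_le_one_of_mul (x := D.f.1 - D'.f.1 + (D.f.2 - D'.f.2)) hl'' b2 b2'
      (by linear_combination e1 + 2 * e2)
    have k3 := abs_le_one_of_mul (x := -(D.f.2 - D'.f.2)) hl'' b3 b3'
      (by linear_combination e1 - e2)
    rw [abs_le] at k1 k2 k3
    have hf : D.f = D'.f := Prod.ext (by omega) (by omega)
    rw [hf] at hcen
    have hlin := add_left_cancel hcen
    -- For `l = m` the triangle lies in the sector `0 < x < y`; exchanging the basis vectors moves
    -- it to the sector of `eq_of_lin_eq`.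
    have hswap : ∀ (g : HexFrame) (p : ℤ × ℤ), g.lin p = HexFrame.lin
        ⟨g.b, g.a, g.norm_b, g.norm_a, by
          rw [← g.norm_sub]; simp only [hexNorm, Prod.fst_sub, Prod.snd_sub]; ring⟩ p.swap := by
      intro g p
      simp [HexFrame.lin, add_comm]
    rw [hswap, hswap (D'.gcFrame l)] at hlin
    obtain ⟨hb, ha⟩ := HexFrame.eq_of_lin_eq hlin h1 h1' h2 h2'
    -- As `shift` preserves the orientation, both frames come from the same branch of `gcFrame`, and
    -- the shift can be undone.
    have hdet : (D.gcFrame l).det = (D'.gcFrame l).det := by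
      simp only at ha hb
      rw [HexFrame.det, HexFrame.det, ha, hb]
    have hg : ∀ E : HexChamber, (E.gcFrame l).det = E.frame.det := by
      intro E
      unfold gcFrame
      split_ifs
      · rfl
      · exact E.frame.det_shift
    rw [hg, hg] at hdet
    simp only [gcFrame, hm, false_or, hdet] at ha hb
    split_ifs at ha hb
    · exact ext_frame hf ha hb
    · refine ext_frame hf hb ?_
      simp only [HexFrame.shift] at ha hb
      rw [hb] at ha
      exact sub_right_injective ha

/-- Every chamber of the tiling lies in exactly one of the big triangles. -/
theorem gcMap_bijective (hl : 0 < l) (hlm : l = m ∨ m = 0)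
    [Nonempty {c : HexChamber // c.InTriangle l m}] :
    Function.Bijective fun x : HexChamber × {c : HexChamber // c.InTriangle l m} =>
      gcMap l m x.1 x.2.1 := by
  constructor
  · rintro ⟨D, c⟩ ⟨D', c'⟩ h
    obtain ⟨rfl, hc⟩ := eq_of_gcMap_eq hl hlm c.2 c'.2 h
    exact congrArg (Prod.mk D) (Subtype.ext hc)
  · obtain ⟨c₀⟩ := ‹Nonempty {c : HexChamber // c.InTriangle l m}›
    refine flip_induction (Z := fun x => ∃ y : HexChamber × {c : HexChamber // c.InTriangle l m},
      gcMap l m y.1 y.2.1 = x) ?_ ⟨(c₀.1, c₀), rfl⟩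
    rintro i _ ⟨⟨D, c⟩, rfl⟩
    by_cases h : (c.1.flip i).InTriangle l m
    · exact ⟨(D, ⟨_, h⟩), gcMap_flip ..⟩
    · refine ⟨(D.flip (c.1.edgeSide l m i), c), gcMap_flip_left hlm D ?_⟩
      exact (edgeOnSide_iff hl hlm c.2).1 (edgeOnSide_edgeSide hl hlm c.2 h)

end HexChamber

/-! ### The hexagonal tiling covers every map with hexagonal faces and vertices of degree three -/

section CoxeterRelations

variable {G : Type*} [Group G] {p q s : G}

/-- The translation that moves a face to an adjacent face, as a word in the generators, and its
conjugates by the rotations around the face. -/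
def hexShift (p q s : G) (j : ℤ) : G := (p * q) ^ j * (p * (p * q) ^ 3 * s) * (p * q) ^ (-j)

theorem rot_conj (hp : p * p = 1) (hq : q * q = 1) : p * (p * q) * p = (p * q)⁻¹ := by
  rw [mul_inv_rev, inv_eq_of_mul_eq_one_right hp, inv_eq_of_mul_eq_one_right hq, ← mul_assoc, hp,
    one_mul]

theorem flip_mul_rot_pow (hp : p * p = 1) (hq : q * q = 1) (n : ℤ) :
    p * (p * q) ^ n = (p * q) ^ (-n) * p := by
  have hp' : p⁻¹ = p := inv_eq_of_mul_eq_one_right hp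
  have h : p * (p * q) ^ n * p⁻¹ = (p * (p * q) * p⁻¹) ^ n := (conj_zpow ..).symm
  rw [hp', rot_conj hp hq, inv_zpow, ← zpow_neg] at h
  rw [← h, mul_assoc, hp, mul_one]

theorem hexShift_conj (j i : ℤ) :
    (p * q) ^ j * hexShift p q s i * (p * q) ^ (-j) = hexShift p q s (j + i) := by
  simp only [hexShift, neg_add_rev, zpow_add]
  simp only [mul_assoc]

/-- A half-turn reverses translations. The half-turn `z = (p * q) ^ 3` commutes with `p`, and `p`
with `s`, so conjugating `p * z * s` by `z` gives its inverse `s * z * p`; other directions follow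
by conjugation with rotations. -/
theorem hexShift_add_three (hp : p * p = 1) (hq : q * q = 1) (hs : s * s = 1) (hps : p * s = s * p)
    (hpq : (p * q) ^ 6 = 1) (j : ℤ) : hexShift p q s (j + 3) = (hexShift p q s j)⁻¹ := by
  have hp' : p⁻¹ = p := inv_eq_of_mul_eq_one_right hp
  have hs' : s⁻¹ = s := inv_eq_of_mul_eq_one_right hs
  have hz : (p * q) ^ 3 * (p * q) ^ 3 = 1 := by rw [← pow_add, hpq]
  have hz' : ((p * q) ^ 3)⁻¹ = (p * q) ^ 3 := inv_eq_of_mul_eq_one_right hz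
  have hzp : p * (p * q) ^ 3 = (p * q) ^ 3 * p := by
    have := flip_mul_rot_pow hp hq 3
    rwa [zpow_neg, zpow_ofNat, hz'] at this
  have h0 : hexShift p q s 3 = (hexShift p q s 0)⁻¹ := by
    simp only [hexShift, zpow_neg, zpow_ofNat, hz', pow_zero, inv_one, mul_one, one_mul,
      mul_inv_rev, hp', hs']
    generalize (p * q) ^ 3 = z at *
    calc z * (p * z * s) * z = z * (p * z) * s * z := by simp only [mul_assoc]
      _ = z * z * (p * s) * z := by rw [hzp]; simp only [mul_assoc]
      _ = s * (p * z) := by rw [hz, hps, one_mul, mul_assoc]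
      _ = s * (z * p) := by rw [hzp]
  rw [← hexShift_conj, h0, ← add_zero j, ← hexShift_conj j 0]
  group

/-- Unit vectors at -60 and 60 degrees add up to the one at 0 degrees. Vertex degree three enters as
the braid relation `q * s * q = s * q * s`. Conjugation by `p` exchanges the two factors and fixes
the product, which gives the other order. -/
theorem hexShift_zero_eq (hp : p * p = 1) (hq : q * q = 1) (hs : s * s = 1) (hps : p * s = s * p)
    (hpq : (p * q) ^ 6 = 1) (hqs : (q * s) ^ 3 = 1) :
    hexShift p q s (-1) * hexShift p q s 1 = hexShift p q s 0 ∧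
      hexShift p q s 1 * hexShift p q s (-1) = hexShift p q s 0 := by
  have hp' : p⁻¹ = p := inv_eq_of_mul_eq_one_right hp
  have hq' : q⁻¹ = q := inv_eq_of_mul_eq_one_right hq
  have hs' : s⁻¹ = s := inv_eq_of_mul_eq_one_right hs
  have hpx : ∀ x, p * (p * x) = x := fun x => by rw [← mul_assoc, hp, one_mul]
  have hqx : ∀ x, q * (q * x) = x := fun x => by rw [← mul_assoc, hq, one_mul]
  obtain ⟨z, hz⟩ : ∃ z, z = (p * q) ^ 3 := ⟨_, rfl⟩
  have hzz : z * z = 1 := by rw [hz, ← pow_add, hpq]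
  have hz' : z⁻¹ = z := inv_eq_of_mul_eq_one_right hzz
  have hz3 : z = p * q * p * q * p * q := by rw [hz, pow_three]; simp only [mul_assoc]
  have hz4 : z = q * p * q * p * q * p := by
    rw [← hz', hz3]
    simp only [mul_inv_rev, hp', hq', mul_assoc]
  have h1 : q * p * z = p * q * p * q := by
    rw [hz3]
    simp only [mul_assoc, hpx, hqx]
  have h2 : q * p * q * p * z = p * q := by
    rw [hz3]
    simp only [mul_assoc, hpx, hqx]
  have hzp : z * p = p * z := by
    conv_lhs => rw [hz4]
    rw [hz3]
    simp only [mul_assoc, hpx, hp, mul_one]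
  have hb : q * s * q = s * q * s := by
    have h : q * s * q * s * q * s = 1 := by
      rw [← hqs, pow_three]
      simp only [mul_assoc]
    have := eq_inv_of_mul_eq_one_left (show q * s * q * (s * q * s) = 1 by
      rw [← h]; simp only [mul_assoc])
    rw [this]
    simp only [mul_inv_rev, hs', hq', mul_assoc]
  have e0 : hexShift p q s 0 = p * z * s := by simp [hexShift, hz]
  have e0p : p * (p * z * s) * p = p * z * s := by
    calc p * (p * z * s) * p = p * p * z * (s * p) := by simp only [mul_assoc]
      _ = z * p * s := by rw [hp, ← hps, one_mul, mul_assoc]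
      _ = p * z * s := by rw [hzp]
  have e1 : hexShift p q s (-1) = q * (p * z * s) * q := by
    have : hexShift p q s (-1) = q * (p * (p * z * s) * p) * q := by
      simp only [hexShift, zpow_neg, neg_neg, zpow_one, mul_inv_rev, hp', hq', ← hz]
      simp only [mul_assoc]
    rw [this, e0p]
  have e2 : hexShift p q s 1 = p * (q * (p * z * s) * q) * p := by
    simp only [hexShift, zpow_neg, zpow_one, mul_inv_rev, hp', hq', ← hz]
    simp only [mul_assoc]
  have key : hexShift p q s (-1) * hexShift p q s 1 = hexShift p q s 0 := by
    rw [e0, e1, e2]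
    calc q * (p * z * s) * q * (p * (q * (p * z * s) * q) * p)
        = (q * p * z) * s * (q * p * q * p * z) * s * q * p := by simp only [mul_assoc]
      _ = p * q * p * q * (s * p) * q * s * q * p := by rw [h1, h2]; simp only [mul_assoc]
      _ = p * q * p * q * p * (s * (q * s * q)) * p := by rw [← hps]; simp only [mul_assoc]
      _ = p * q * p * q * p * q * (s * p) := by
        rw [hb, show s * (s * q * s) = s * s * q * s by simp only [mul_assoc], hs, one_mul]
        simp only [mul_assoc]
      _ = z * p * s := by rw [← hz3, ← hps, mul_assoc]
      _ = p * z * s := by rw [hzp]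
  refine ⟨key, ?_⟩
  have h : p * (hexShift p q s (-1) * hexShift p q s 1) * p =
      hexShift p q s 1 * hexShift p q s (-1) := by
    rw [e1, e2]
    simp only [mul_assoc, hp, mul_one]
  rw [← h, key, e0, e0p]

theorem hexShift_eq (hp : p * p = 1) (hq : q * q = 1) (hs : s * s = 1) (hps : p * s = s * p)
    (hpq : (p * q) ^ 6 = 1) (hqs : (q * s) ^ 3 = 1) (j : ℤ) :
    hexShift p q s (j + 1) * hexShift p q s (j - 1) = hexShift p q s j ∧
      hexShift p q s (j - 1) * hexShift p q s (j + 1) = hexShift p q s j := by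
  obtain ⟨h1, h2⟩ := hexShift_zero_eq hp hq hs hps hpq hqs
  have hmul : ∀ x y : G, (p * q) ^ j * (x * y) * (p * q) ^ (-j) =
      ((p * q) ^ j * x * (p * q) ^ (-j)) * ((p * q) ^ j * y * (p * q) ^ (-j)) := by
    intro x y
    group
  have h1 := congrArg (fun x => (p * q) ^ j * x * (p * q) ^ (-j)) h1
  have h2 := congrArg (fun x => (p * q) ^ j * x * (p * q) ^ (-j)) h2
  simp only [hmul, hexShift_conj, add_zero, ← sub_eq_add_neg] at h1 h2
  exact ⟨h2, h1⟩

/-- Crossing an edge is translating to the adjacent face and then moving within that face. The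
chamber reached is reversed, which accounts for `q`. -/
theorem hexShift_cross (hp : p * p = 1) (hq : q * q = 1) (hpq : (p * q) ^ 6 = 1) (j : ℤ) :
    s * (p * q) ^ (-j) = q * (p * q) ^ (-(j + 4)) * hexShift p q s j := by
  have hp' : p⁻¹ = p := inv_eq_of_mul_eq_one_right hp
  have hq' : q⁻¹ = q := inv_eq_of_mul_eq_one_right hq
  have h6 : (p * q) ^ (-7 : ℤ) = q * p := by
    have : (p * q) ^ (-7 : ℤ) = ((p * q) ^ 6)⁻¹ * (p * q)⁻¹ := by
      rw [← zpow_natCast, ← zpow_neg, ← zpow_neg_one (p * q), ← zpow_add]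
      norm_num
    rw [this, hpq, inv_one, one_mul, mul_inv_rev, hp', hq']
  have h3 : p * (p * q) ^ 3 = (p * q) ^ (-3 : ℤ) * p := by
    have := flip_mul_rot_pow hp hq 3
    rwa [zpow_ofNat] at this
  have : q * (p * q) ^ (-(j + 4)) * hexShift p q s j =
      q * (p * q) ^ (-4 : ℤ) * (p * (p * q) ^ 3) * s * (p * q) ^ (-j) := by
    rw [hexShift, show -(j + 4) = -4 + -j by ring, zpow_add, zpow_neg _ j]
    simp only [mul_assoc, inv_mul_cancel_left]
  rw [this, h3, ← mul_assoc, mul_assoc q, ← zpow_add]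
  norm_num only
  rw [h6]
  simp only [← mul_assoc, hq, one_mul]
  rw [hp, one_mul]

/-- The translation with the given coordinates. -/
def hexTranslation (p q s : G) (x y : ℤ) : G := hexShift p q s 0 ^ x * hexShift p q s 1 ^ y

/-- The direction of a unit vector as a multiple of 60 degrees. -/
def hexDir (a : ℤ × ℤ) : ℤ :=
  if a = (1, 0) then 0 else if a = (0, 1) then 1 else if a = (-1, 1) then 2
  -- Among unit vectors the last case is `(1, -1)`.
  else if a = (-1, 0) then 3 else if a = (0, -1) then 4 else 5

/-- Write `A`, `B` for the shifts in directions 0 and 1. Direction 2 equals both `A⁻¹ * B` and `B *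
A⁻¹`, so `A` and `B` commute, and the remaining directions are inverses. Thus the six shifts act
additively on coordinates. -/
theorem hexShift_mul_translation (hp : p * p = 1) (hq : q * q = 1) (hs : s * s = 1)
    (hps : p * s = s * p) (hpq : (p * q) ^ 6 = 1) (hqs : (q * s) ^ 3 = 1) {a : ℤ × ℤ}
    (ha : hexNorm a = 1) (x y : ℤ) :
    hexShift p q s (hexDir a) * hexTranslation p q s x y =
      hexTranslation p q s (x + a.1) (y + a.2) := by
  have h3 := hexShift_add_three hp hq hs hps hpq
  have hmid := hexShift_eq hp hq hs hps hpq hqs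
  have t3 : hexShift p q s 3 = (hexShift p q s 0)⁻¹ := h3 0
  have t4 : hexShift p q s 4 = (hexShift p q s 1)⁻¹ := h3 1
  have t5 : hexShift p q s 5 = (hexShift p q s 2)⁻¹ := h3 2
  have m1 := (hmid 2).1
  have m2 := (hmid 2).2
  norm_num only at m1 m2
  rw [t3] at m1 m2
  unfold hexTranslation
  obtain ⟨A, hA⟩ : ∃ A, hexShift p q s 0 = A := ⟨_, rfl⟩
  obtain ⟨B, hB⟩ : ∃ B, hexShift p q s 1 = B := ⟨_, rfl⟩
  rw [hA] at t3 m1 m2 ⊢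
  rw [hB] at t4 m1 m2 ⊢
  have hAB : Commute A B := (Commute.inv_left_iff (a := A)).1 (m1.trans m2.symm)
  have hBx : B * A ^ x = A ^ x * B := (hAB.symm.zpow_right x).eq
  have hBx' : B⁻¹ * A ^ x = A ^ x * B⁻¹ := (hAB.symm.inv_left.zpow_right x).eq
  rcases HexChamber.hexNorm_eq_one ha with h | h | h | h | h | h <;>
    simp only [hexDir, Prod.ext_iff, h]
  · norm_num
    rw [hA, ← mul_assoc, add_comm x, zpow_one_add]
  · norm_num
    rw [hB, ← mul_assoc, hBx, mul_assoc, add_comm y, zpow_one_add]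
  · norm_num
    rw [← m1, add_comm y, zpow_one_add, add_comm x, zpow_add, zpow_neg_one, mul_assoc, ← mul_assoc B,
      hBx]
    simp only [mul_assoc]
  · norm_num
    rw [t3, ← mul_assoc, add_comm x, zpow_add, zpow_neg_one]
  · norm_num
    rw [t4, ← mul_assoc, hBx', mul_assoc, add_comm y, zpow_add, zpow_neg_one]
  · norm_num
    rw [t5, ← m2, mul_inv_rev, inv_inv, add_comm x, zpow_one_add, add_comm y, zpow_add,
      zpow_neg_one, mul_assoc A, ← mul_assoc B⁻¹, hBx']
    simp only [mul_assoc]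

end CoxeterRelations

/-! ### Construction of the covering from the Coxeter relations. -/

namespace HexChamber

variable {X : Type*} {p q s : Equiv.Perm X}

open Classical in
/-- The image of a chamber in a set on which the reflections act, where the chamber at the origin
is mapped to `x₀`. -/
noncomputable def cover (p q s : Equiv.Perm X) (x₀ : X) (c : HexChamber) : X :=
  (if c.frame.det = 1 then 1 else q) (((p * q) ^ (-hexDir c.frame.a) : Equiv.Perm X)
    -- The coordinates of the face centre in the basis `(1, 1)`, `(-1, 2)`, as in `std`; the
    -- divisions are exact by `face_center`.
    (hexTranslation p q s (c.f.1 + (c.f.2 - c.f.1) / 3) ((c.f.2 - c.f.1) / 3) x₀))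

theorem cover_eq_of_det_one (x₀ : X) {c : HexChamber} (h : c.frame.det = 1) :
    cover p q s x₀ c = ((p * q) ^ (-hexDir c.frame.a) : Equiv.Perm X)
      (hexTranslation p q s (c.f.1 + (c.f.2 - c.f.1) / 3) ((c.f.2 - c.f.1) / 3) x₀) := by
  simp [cover, h]

theorem cover_eq_of_det_neg_one (x₀ : X) {c : HexChamber} (h : c.frame.det = -1) :
    cover p q s x₀ c = q (((p * q) ^ (-hexDir c.frame.a) : Equiv.Perm X)
      (hexTranslation p q s (c.f.1 + (c.f.2 - c.f.1) / 3) ((c.f.2 - c.f.1) / 3) x₀)) := by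
  simp [cover, h]

/-- Flips are involutions that reverse the orientation, so it suffices to start from direct
chambers. The flips of colours 0 and 1 stay in the face; that of colour 2 moves to another face and
rests on `hexShift_cross` and the additivity of translations. -/
theorem cover_flip (hp : p * p = 1) (hq : q * q = 1) (hs : s * s = 1)
    (hps : p * s = s * p) (hpq : (p * q) ^ 6 = 1) (hqs : (q * s) ^ 3 = 1) (x₀ : X) (i : Fin 3)
    (c : HexChamber) : cover p q s x₀ (c.flip i) = ![p, q, s] i (cover p q s x₀ c) := by
  have h6 : ∀ n : ℤ, (p * q) ^ (n + 6) = (p * q) ^ n := fun n => by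
    rw [zpow_add]
    norm_cast
    rw [hpq, mul_one]
  have h6 : ∀ m n : ℤ, m = n ∨ n = m + 6 → (p * q) ^ m = (p * q) ^ n := by
    rintro m n (rfl | rfl)
    · rfl
    · rw [h6]
  have hinv : ∀ (i : Fin 3) x, ![p, q, s] i (![p, q, s] i x) = x := by
    intro i x
    fin_cases i
    · exact congrArg (fun f : Equiv.Perm X => f x) hp
    · exact congrArg (fun f : Equiv.Perm X => f x) hq
    · exact congrArg (fun f : Equiv.Perm X => f x) hs
  suffices H : ∀ c : HexChamber, c.frame.det = 1 →
      cover p q s x₀ (c.flip i) = ![p, q, s] i (cover p q s x₀ c) by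
    rcases c.frame.det_cases with h | h
    · exact H c h.1
    · have h' := H (c.flip i) (by rw [det_flip, h.1, neg_neg])
      rw [flip_flip] at h'
      rw [h', hinv]
  clear c hinv
  intro c hc
  have hb : c.frame.b = (-c.frame.a.2, c.frame.a.1 + c.frame.a.2) := by
    rcases c.frame.det_cases with h | h
    · exact Prod.ext h.2.1 h.2.2
    · omega
  rw [cover_eq_of_det_neg_one _ (by rw [det_flip, hc]), cover_eq_of_det_one _ hc]
  have ha := c.frame.norm_a
  obtain rfl | rfl | rfl : i = 0 ∨ i = 1 ∨ i = 2 := by clear * -; revert i; decide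
  -- The direction grows by one, modulo 6. For the flip of colour 2 the new vector is `-b`, and the
  -- direction grows by `1 + 3`.
  · have key : q * (p * q) ^ (-hexDir (c.flip 0).frame.a) = p * (p * q) ^ (-hexDir c.frame.a) := by
      rw [c.frame_flip_zero.1, hb]
      have h0 : ∀ n : ℤ, p * (p * q) ^ (-n) = q * (p * q) ^ (-(n + 1)) := by
        intro n
        rw [neg_add_rev, zpow_add, zpow_neg_one, ← mul_assoc, mul_inv_rev,
          inv_eq_of_mul_eq_one_right hp, inv_eq_of_mul_eq_one_right hq, ← mul_assoc, hq, one_mul]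
      rw [h0]
      congr 1
      refine (h6 _ _ ?_).symm
      rcases hexNorm_eq_one ha with h | h | h | h | h | h <;>
        simp only [hexDir, Prod.ext_iff, h] <;> norm_num
    rw [c.frame_flip_zero.2.2]
    exact congrArg (fun f : Equiv.Perm X => f _) key
  · rw [c.frame_flip_one.2.2, c.frame_flip_one.1]
    rfl
  · have key : q * (p * q) ^ (-hexDir (c.flip 2).frame.a) =
        q * (p * q) ^ (-(hexDir c.frame.a + 4)) := by
      rw [c.frame_flip_two.1, hb]
      congr 1
      refine (h6 _ _ ?_).symm
      rcases hexNorm_eq_one ha with h | h | h | h | h | h <;>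
        simp only [hexDir, Prod.ext_iff, h] <;> norm_num
    -- The displacement `a + b` of the face centre has the coordinates of `a` with respect to `(1,
    -- 1)`, `(-1, 2)`.
    have hf1 : (c.flip 2).f.1 = c.f.1 + (c.frame.a.1 - c.frame.a.2) := by
      rw [c.frame_flip_two.2.2, hb]
      simp
      ring
    have hf2 : (c.flip 2).f.2 = c.f.2 + (c.frame.a.1 + 2 * c.frame.a.2) := by
      rw [c.frame_flip_two.2.2, hb]
      simp
      ring
    obtain ⟨t, ht⟩ := c.face_center
    have e1 : ((c.flip 2).f.2 - (c.flip 2).f.1) / 3 = (c.f.2 - c.f.1) / 3 + c.frame.a.2 := by omega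
    have e2 : (c.flip 2).f.1 + ((c.flip 2).f.2 - (c.flip 2).f.1) / 3 =
        c.f.1 + (c.f.2 - c.f.1) / 3 + c.frame.a.1 := by omega
    rw [e2, e1, ← hexShift_mul_translation hp hq hs hps hpq hqs ha]
    show (q * (p * q) ^ (-hexDir (c.flip 2).frame.a)) _ = (s * (p * q) ^ (-hexDir c.frame.a)) _
    rw [key, hexShift_cross (s := s) hp hq hpq]
    rfl

theorem cover_std (x₀ : X) : cover p q s x₀ (std 0 0) = x₀ := by
  rw [cover_eq_of_det_one]
  · simp [std, frame, hexDir, hexTranslation]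
  · simp [std, frame, HexFrame.det]

end HexChamber

/-! ### Coverings of hexagonal maps by the tiling and their invariance. -/

namespace SurfaceMap

variable {P : SurfaceMap.{u}}

open Function

/-- The adjacency as a permutation of the chambers. -/
def rPerm (P : SurfaceMap.{u}) (i : Fin 3) : Equiv.Perm P.Chamber :=
  Involutive.toPerm (P.r i) (P.r_r i)

theorem rPerm_mul_pow_eq_one {i j : Fin 3} {n : ℕ} (h : ∀ C, minimalPeriod (P.spin i j) C = n) :
    (P.rPerm i * P.rPerm j) ^ n = 1 := by
  ext C
  rw [Equiv.Perm.coe_pow]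
  show (P.spin i j)^[n] C = C
  rw [← h C, iterate_minimalPeriod]

/-- A map in which all faces have size six and all vertices have degree three. -/
structure IsHexagonal (P : SurfaceMap.{u}) : Prop where
  orientable : P.IsOrientable
  face : ∀ C, minimalPeriod (P.spin 0 1) C = 6
  vertex : ∀ C, minimalPeriod (P.spin 1 2) C = 3

/-- A morphism from the hexagonal tiling. -/
def IsCovering (P : SurfaceMap.{u}) (π : HexChamber → P.Chamber) : Prop :=
  ∀ i c, π (c.flip i) = P.r i (π c)

theorem IsHexagonal.exists_covering (hP : P.IsHexagonal) (C : P.Chamber) :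
    ∃ π, P.IsCovering π ∧ π (HexChamber.std 0 0) = C := by
  have hr : ∀ i, P.rPerm i * P.rPerm i = 1 := fun i => Equiv.ext (P.r_r i)
  refine ⟨HexChamber.cover (P.rPerm 0) (P.rPerm 1) (P.rPerm 2) C, fun i c => ?_,
    HexChamber.cover_std C⟩
  rw [HexChamber.cover_flip (hr 0) (hr 1) (hr 2) (Equiv.ext P.r_comm)
    (rPerm_mul_pow_eq_one hP.face) (rPerm_mul_pow_eq_one hP.vertex)]
  fin_cases i <;> rfl

theorem IsHexagonal.spin_iterate_ne (hP : P.IsHexagonal) {n : ℕ} (h0 : 0 < n) (h6 : n < 6)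
    (C : P.Chamber) : (P.spin 1 0)^[n] C ≠ C := by
  -- Both senses of rotation have the same period, half the number of chambers of the face.
  have h : minimalPeriod (P.spin 1 0) C = 6 := by
    have h1 := card_cell hP.orientable (i := 1) (j := 0) (k := 2) (by decide) (by decide)
      (by decide) C
    have h2 := card_cell hP.orientable (i := 0) (j := 1) (k := 2) (by decide) (by decide)
      (by decide) C
    rw [hP.face] at h2
    omega
  exact not_isPeriodicPt_of_pos_of_lt_minimalPeriod h0.ne' (by omega)

theorem IsHexagonal.r_one_ne_r_two (hP : P.IsHexagonal) (C : P.Chamber) : P.r 1 C ≠ P.r 2 C := by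
  intro h
  have h1 : IsPeriodicPt (P.spin 1 2) 1 C := by
    show P.r 1 (P.r 2 C) = C
    rw [← h, P.r_r]
  have := h1.minimalPeriod_le one_pos
  rw [hP.vertex] at this
  omega

theorem IsHexagonal.r_zero_r_two_ne (C : P.Chamber) : P.r 0 (P.r 2 C) ≠ C := by
  intro h
  apply P.r_zero_ne_r_two C
  conv_lhs => rw [← h, P.r_r]

variable {π π' : HexChamber → P.Chamber}

theorem IsCovering.ext (hπ : P.IsCovering π) (hπ' : P.IsCovering π') {c : HexChamber}
    (h : π c = π' c) : π = π' := by
  funext d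
  refine HexChamber.flip_induction (Z := fun d => π d = π' d) (fun i d hd => ?_) h d
  rw [hπ, hπ', hd]

theorem IsCovering.comp_app (hπ : P.IsCovering π) (g : HexFrame) (t : ℤ × ℤ)
    (ht : 3 ∣ t.1 - t.2) : P.IsCovering fun c => π (g.app t ht c) := by
  intro i c
  show π (g.app t ht (c.flip i)) = _
  rw [g.app_flip, hπ]

theorem IsCovering.surjective (hπ : P.IsCovering π) (hP : P.IsConnected) : Surjective π := by
  intro C
  induction hP.2 (π (HexChamber.std 0 0)) C with
  | refl => exact ⟨_, rfl⟩
  | tail _ h ih =>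
    obtain ⟨c, rfl⟩ := ih
    obtain ⟨i, rfl⟩ := h
    exact ⟨c.flip i, hπ i c⟩

theorem IsCovering.turn (hπ : P.IsCovering π) (c : HexChamber) (n : ℕ) :
    π (c.turn (2 * n)) = (P.spin 1 0)^[n] (π c) := by
  induction n with
  | zero => rfl
  | succ n ih =>
    rw [iterate_succ_apply', ← ih, show 2 * (n + 1) = 2 * n + 1 + 1 by ring]
    simp only [HexChamber.turn, hπ _ _]
    rw [if_neg (by omega), if_pos (by omega)]
    rfl

/-- The orientation of the image of a chamber only depends on the orientation of the chamber. -/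
theorem IsCovering.det_eq (hP : P.IsOrientable) (hπ : P.IsCovering π) {c d : HexChamber}
    (h : π c = π d) : c.frame.det = d.frame.det := by
  obtain ⟨o, ho⟩ := hP
  have key : ∀ d, o (π d) = o (π c) ↔ d.frame.det = c.frame.det := by
    refine HexChamber.flip_induction (fun i d hd => ?_) (c := c) (by simp)
    rw [hπ, ho, HexChamber.det_flip]
    have h1 := c.frame.det_cases
    have h2 := d.frame.det_cases
    constructor
    · intro h
      have : ¬ o (π d) = o (π c) := by rw [← h]; simp
      rw [hd] at this
      omega
    · intro h
      have : ¬ o (π d) = o (π c) := by rw [hd]; omega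
      cases h3 : o (π d) <;> cases h4 : o (π c) <;> simp_all
  exact ((key d).1 (by rw [h])).symm

/-- An orientation preserving symmetry of the tiling under which a covering is invariant is
a translation: otherwise it is a rotation around a cell, and this cell would be mapped to
a smaller cell. -/
theorem IsCovering.frame_eq_std (hP : P.IsHexagonal) (hπ : P.IsCovering π) {D : HexChamber}
    (hD : π D = π (HexChamber.std 0 0)) : D.frame.a = (1, 0) ∧ D.frame.b = (0, 1) := by
  -- The isometry that takes the standard chamber to `D` leaves `π` invariant, since two coverings
  -- that agree at one chamber are equal.
  have hinv : ∀ c, π (D.frame.app D.f D.face_center c) = π c := by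
    refine congrFun (IsCovering.ext (hπ.comp_app _ _ _) hπ (c := HexChamber.std 0 0) ?_)
    rw [HexChamber.frame_app_std, hD]
  have hdet := hπ.det_eq hP.orientable hD
  have hturn : ∀ n, 0 < n → n < 6 → ∀ c, D.frame.app D.f D.face_center c ≠ c.turn (2 * n) := by
    intro n h0 h6 c h
    have := hinv c
    rw [h, hπ.turn] at this
    exact hP.spin_iterate_ne h0 h6 _ this
  have hvertex : ∀ c, D.frame.app D.f D.face_center c ≠ (c.flip 1).flip 2 := by
    intro c h
    have := hinv c
    rw [h, hπ, hπ] at this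
    apply hP.r_one_ne_r_two (π c)
    conv_rhs => rw [← this, P.r_r]
  have hvertex' : ∀ c, D.frame.app D.f D.face_center c ≠ (c.flip 2).flip 1 := by
    intro c h
    have := hinv c
    rw [h, hπ, hπ] at this
    apply hP.r_one_ne_r_two (π c)
    conv_lhs => rw [← this, P.r_r]
  have hedge : ∀ c, D.frame.app D.f D.face_center c ≠ (c.flip 2).flip 0 := by
    intro c h
    have := hinv c
    rw [h, hπ, hπ] at this
    exact IsHexagonal.r_zero_r_two_ne _ this
  obtain ⟨t, ht⟩ := D.face_center
  have ht : D.f.1 = D.f.2 + 3 * t := by omega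
  obtain ⟨u, hu⟩ : ∃ u, D.f.2 = 3 * u ∨ D.f.2 = 3 * u + 1 ∨ D.f.2 = 3 * u + 2 :=
    ⟨D.f.2 / 3, by omega⟩
  -- A rotation by 60 or 300 degrees fixes a face centre. By 120 or 240 degrees it fixes a face
  -- centre or a vertex, according to `D.f.2` modulo 3. A half-turn fixes a face centre or the
  -- midpoint of an edge, according to the parities of the lattice coordinates of `D.f`. The
  -- witnesses are chambers at the fixed cell.
  rcases D.frame.shape with h | h | h | h | h | h | h | h | h | h | h | h
  · exact h
  · refine absurd ?_ (hturn 1 (by decide) (by decide) (HexChamber.std t (D.f.2 + t)))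
    ext <;> simp [HexFrame.app, HexFrame.lin, HexChamber.std, HexChamber.turn, HexChamber.flip, h]
      <;> omega
  · rcases hu with hu | hu | hu
    · refine absurd ?_ (hturn 2 (by decide) (by decide) (HexChamber.std (t + u) u))
      ext <;> simp [HexFrame.app, HexFrame.lin, HexChamber.std, HexChamber.turn, HexChamber.flip, h]
        <;> omega
    · refine absurd ?_ (hvertex' ((HexChamber.std (t + u) u).turn 1))
      ext <;> simp [HexFrame.app, HexFrame.lin, HexChamber.std, HexChamber.turn, HexChamber.flip, h]
        <;> omega
    · refine absurd ?_ (hvertex (HexChamber.std (t + u) (u + 1)))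
      ext <;> simp [HexFrame.app, HexFrame.lin, HexChamber.std, HexChamber.flip, h]
        <;> omega
  · obtain ⟨x, hx⟩ : ∃ x, D.f.1 - t = 2 * x ∨ D.f.1 - t = 2 * x + 1 := ⟨(D.f.1 - t) / 2, by omega⟩
    obtain ⟨y, hy⟩ : ∃ y, -t = 2 * y ∨ -t = 2 * y + 1 := ⟨-t / 2, by omega⟩
    rcases hx with hx | hx <;> rcases hy with hy | hy
    · refine absurd ?_ (hturn 3 (by decide) (by decide) (HexChamber.std x y))
      ext <;> simp [HexFrame.app, HexFrame.lin, HexChamber.std, HexChamber.turn, HexChamber.flip, h]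
        <;> omega
    · refine absurd ?_ (hedge ((HexChamber.std x y).turn 2))
      ext <;> simp [HexFrame.app, HexFrame.lin, HexChamber.std, HexChamber.turn, HexChamber.flip, h]
        <;> omega
    · refine absurd ?_ (hedge (HexChamber.std x y))
      ext <;> simp [HexFrame.app, HexFrame.lin, HexChamber.std, HexChamber.flip, h]
        <;> omega
    · refine absurd ?_ (hedge ((HexChamber.std (x + 1) y).turn 4))
      ext <;> simp [HexFrame.app, HexFrame.lin, HexChamber.std, HexChamber.turn, HexChamber.flip, h]
        <;> omega
  · rcases hu with hu | hu | hu
    · refine absurd ?_ (hturn 4 (by decide) (by decide) (HexChamber.std (2 * u + t) (-t - u)))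
      ext <;> simp [HexFrame.app, HexFrame.lin, HexChamber.std, HexChamber.turn, HexChamber.flip, h]
        <;> omega
    · refine absurd ?_ (hvertex' (HexChamber.std (2 * u + t) (-t - u)))
      ext <;> simp [HexFrame.app, HexFrame.lin, HexChamber.std, HexChamber.flip, h]
        <;> omega
    · refine absurd ?_ (hvertex ((HexChamber.std (2 * u + t + 1) (-t - u - 1)).turn 1))
      ext <;> simp [HexFrame.app, HexFrame.lin, HexChamber.std, HexChamber.turn, HexChamber.flip, h]
        <;> omega
  · refine absurd ?_ (hturn 5 (by decide) (by decide) (HexChamber.std (D.f.2 + t) (-D.f.2 - 2 * t)))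
    ext <;> simp [HexFrame.app, HexFrame.lin, HexChamber.std, HexChamber.turn, HexChamber.flip, h]
      <;> omega
  -- The reversed frames contradict the equality of orientations.
  all_goals
    simp [HexFrame.det, h] at hdet
    simp [HexChamber.frame, HexChamber.std] at hdet

end SurfaceMap

/-! ### The fibres of a covering are orbits of translations. -/

namespace HexChamber

/-- The image of a chamber under a translation. -/
def translate (t : ℤ × ℤ) (ht : 3 ∣ t.1 - t.2) (c : HexChamber) : HexChamber where
  f := t + c.f
  v := t + c.v
  w := t + c.w
  face_center := by
    have := c.face_center
    simp only [Prod.fst_add, Prod.snd_add]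
    omega
  norm_v := by rw [add_sub_add_left_eq_sub, c.norm_v]
  norm_w := by rw [add_sub_add_left_eq_sub, c.norm_w]
  norm_edge := by rw [add_sub_add_left_eq_sub, c.norm_edge]

theorem translate_flip (t : ℤ × ℤ) (ht : 3 ∣ t.1 - t.2) (i : Fin 3) (c : HexChamber) :
    (c.flip i).translate t ht = (c.translate t ht).flip i := by
  fin_cases i <;> ext <;> simp [translate, HexChamber.flip] <;> ring

end HexChamber

namespace SurfaceMap

variable {P : SurfaceMap.{u}} {π : HexChamber → P.Chamber}

/-- The fibers of a covering are orbits of translations. -/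
theorem IsCovering.exists_translate (hP : P.IsHexagonal) (hπ : P.IsCovering π) {D D' : HexChamber}
    (h : π D = π D') : ∃ t ht, D' = D.translate t ht ∧ ∀ c, π (c.translate t ht) = π c := by
  suffices H : ∃ t ht, D' = D.translate t ht by
    obtain ⟨t, ht, rfl⟩ := H
    refine ⟨t, ht, rfl, congrFun (IsCovering.ext (c := D) ?_ hπ h.symm)⟩
    intro i c
    show π ((c.flip i).translate t ht) = _
    rw [HexChamber.translate_flip, hπ]
  have hsurj : ∀ d, ∃ c, D.frame.app D.f D.face_center c = d := by
    refine HexChamber.flip_induction ?_ ⟨HexChamber.std 0 0, rfl⟩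
    rintro i _ ⟨c, rfl⟩
    exact ⟨c.flip i, HexFrame.app_flip ..⟩
  -- Moving `D` to the standard chamber turns `π` into another covering, to which `frame_eq_std`
  -- applies with `E` in the place of `D'`.
  obtain ⟨E, rfl⟩ := hsurj D'
  have hfr := IsCovering.frame_eq_std hP (hπ.comp_app D.frame D.f D.face_center) (D := E)
    (by rw [HexChamber.frame_app_std, h])
  refine ⟨D.frame.lin E.f, D.frame.three_dvd_lin E.face_center, ?_⟩
  have hv : E.v = E.f + (1, 0) := by rw [← hfr.1]; simp [HexChamber.frame]
  have hw : E.w = E.f + (0, 1) := by rw [← hfr.2]; simp [HexChamber.frame]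
  refine HexChamber.ext ?_ ?_ ?_
  · simp [HexFrame.app, HexChamber.translate, add_comm]
  · simp only [HexFrame.app, HexChamber.translate, hv, HexFrame.lin_add]
    simp [HexFrame.lin, HexChamber.frame, Prod.ext_iff]
    exact ⟨by ring, by ring⟩
  · simp only [HexFrame.app, HexChamber.translate, hw, HexFrame.lin_add]
    simp [HexFrame.lin, HexChamber.frame, Prod.ext_iff]
    exact ⟨by ring, by ring⟩

end SurfaceMap

/-! ### Translations and the scaled tiling. -/

namespace HexChamber

variable {l m : ℕ}

theorem frame_translate (t : ℤ × ℤ) (ht : 3 ∣ t.1 - t.2) (c : HexChamber) :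
    (c.translate t ht).frame = c.frame := by
  simp [frame, translate]

theorem gcMap_translate (t : ℤ × ℤ) (ht : 3 ∣ t.1 - t.2) (D c : HexChamber) :
    gcMap l m (D.translate t ht) c =
      (gcMap l m D c).translate (gcScale l m t) (three_dvd_gcScale l m ht) := by
  have h : (D.translate t ht).gcFrame m = D.gcFrame m := by
    unfold gcFrame
    rw [frame_translate]
  refine HexChamber.ext ?_ ?_ ?_
  all_goals
    simp only [gcMap, HexFrame.app, h]
    simp only [translate, gcScale_add, add_assoc]

theorem translate_comm (t t' : ℤ × ℤ) (ht : 3 ∣ t.1 - t.2) (ht' : 3 ∣ t'.1 - t'.2)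
    (c : HexChamber) : (c.translate t ht).translate t' ht' = (c.translate t' ht').translate t ht := by
  refine HexChamber.ext ?_ ?_ ?_ <;> simp only [translate] <;> abel

/-- Besides nonemptiness, the position at the corner `v₂` matters: the copy of this chamber at `D`
has its face centre exactly at `gcScale l m D.f`. -/
theorem exists_inTriangle (hl : 0 < l) (hlm : l = m ∨ m = 0) :
    ∃ c : HexChamber, c.f = (0, 0) ∧ c.InTriangle l m := by
  have hl' : (1 : ℤ) ≤ l := by exact_mod_cast hl
  by_cases hm : m = 0
  · refine ⟨std 0 0, by simp [std], (inTriangle_iff hl hlm).2 fun j k => ?_⟩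
    fin_cases j <;> fin_cases k <;> simp [gcWall, hm, dbl, std] <;> omega
  · refine ⟨(std 0 0).flip 0, by simp [std, flip], (inTriangle_iff hl hlm).2 fun j k => ?_⟩
    fin_cases j <;> fin_cases k <;> simp [gcWall, hm, dbl, std, flip] <;> omega

/-- The triangulated big triangles form the tiling. -/
noncomputable def gcEquiv (hl : 0 < l) (hlm : l = m ∨ m = 0) :
    HexChamber × {c : HexChamber // c.InTriangle l m} ≃ HexChamber :=
  have : Nonempty {c : HexChamber // c.InTriangle l m} :=
    let ⟨c, hc⟩ := exists_inTriangle hl hlm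
    ⟨⟨c, hc.2⟩⟩
  Equiv.ofBijective _ (gcMap_bijective hl hlm)

theorem gcEquiv_apply (hl : 0 < l) (hlm : l = m ∨ m = 0) (D : HexChamber)
    (c : {c : HexChamber // c.InTriangle l m}) : gcEquiv hl hlm (D, c) = gcMap l m D c.1 := rfl

/-- The vector `(1, 1)` is a shortest nonzero vector of the lattice of face centres, and a proper
enlargement of this lattice has no vector that short. Arithmetically, 1 would be a multiple of `l >
1`, or of 3 if `l = m`. -/
theorem gcScale_ne (hl : 0 < l) (hlm : l = m ∨ m = 0) (hne : (l, m) ≠ (1, 0)) {p : ℤ × ℤ}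
    (hp : 3 ∣ p.1 - p.2) : gcScale l m p ≠ (1, 1) := by
  intro h
  simp only [gcScale, Prod.ext_iff] at h
  by_cases hm : m = 0
  · subst hm
    have h1 : (l : ℤ) * p.1 = 1 := by linear_combination h.1
    have h2 := Int.isUnit_iff.1 (IsUnit.of_mul_eq_one _ h1)
    apply hne
    rw [show l = 1 by omega]
  · obtain rfl : l = m := by tauto
    obtain ⟨t, ht⟩ := hp
    have h1 : (3 : ℤ) * (l * t) = 1 := by linear_combination h.1 - l * ht
    omega

end HexChamber

/-! ### Automorphisms induced by translations and the increase of symmetry. -/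

namespace SurfaceMap

variable {P : SurfaceMap.{u}}

theorem finite_aut : Finite P.Aut := by
  have := P.finite_chamber
  exact Subtype.finite

/-- A translation of the tiling that is compatible with a covering induces an automorphism. -/
theorem IsCovering.exists_aut {π : HexChamber → P.Chamber} (hπ : P.IsCovering π)
    (hs : Function.Surjective π)
    (h : ∀ c d t ht, π c = π d → π (c.translate t ht) = π (d.translate t ht))
    (t : ℤ × ℤ) (ht : 3 ∣ t.1 - t.2) : ∃ φ : P.Aut, ∀ c, φ.1 (π c) = π (c.translate t ht) := by
  have hF : ∀ t ht, ∃ F : P.Chamber → P.Chamber, ∀ c, F (π c) = π (c.translate t ht) :=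
    fun t ht => ⟨fun C => π ((Function.surjInv hs C).translate t ht),
      fun c => h _ _ _ _ (Function.surjInv_eq hs _)⟩
  obtain ⟨F, hF₁⟩ := hF t ht
  obtain ⟨F', hF'⟩ := hF (-t) (by simp only [Prod.fst_neg, Prod.snd_neg]; omega)
  refine ⟨⟨⟨F, F', ?_, ?_⟩, ?_⟩, hF₁⟩
  · refine hs.forall.2 fun c => ?_
    rw [hF₁, hF']
    congr 1
    ext <;> simp [HexChamber.translate]
  · refine hs.forall.2 fun c => ?_
    rw [hF', hF₁]
    congr 1
    ext <;> simp [HexChamber.translate]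
  · intro i
    refine hs.forall.2 fun c => ?_
    show F (P.r i (π c)) = P.r i (F (π c))
    rw [← hπ, hF₁, hF₁, HexChamber.translate_flip, hπ]

/-- An automorphism of a map as an automorphism of the result of an operation. -/
def Aut.apply (O : LocalOperation) (φ : P.Aut) : (O.apply P).Aut :=
  ⟨φ.1.prodCongr (Equiv.refl _), by
    rintro i ⟨C, c⟩
    show (φ.1.prodCongr (Equiv.refl _)) (O.glue P i (C, c)) = O.glue P i (φ.1 C, c)
    rcases h : O.adj i c with c' | k
    · rw [LocalOperation.glue_inl h, LocalOperation.glue_inl h]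
      rfl
    · rw [LocalOperation.glue_inr h, LocalOperation.glue_inr h, ← φ.2]
      rfl⟩

theorem Aut.apply_injective {O : LocalOperation} (hO : Nonempty O.Chamber) :
    Function.Injective (Aut.apply (P := P) O) := by
  intro φ ψ h
  obtain ⟨c⟩ := hO
  refine Subtype.ext (Equiv.ext fun C => ?_)
  have := congrArg (fun χ : (O.apply P).Aut => χ.1 (C, c)) h
  exact congrArg Prod.fst this

section GoldbergCoxeter

variable {l m : ℕ} (hl : 0 < l) (hlm : l = m ∨ m = 0) {π : HexChamber → P.Chamber}

/-- The covering of the result of a Goldberg–Coxeter operation. -/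
noncomputable def gcCovering (hl : 0 < l) (hlm : l = m ∨ m = 0) (π : HexChamber → P.Chamber)
    (x : HexChamber) : ((goldbergCoxeter l m hl hlm).apply P).Chamber :=
  (π ((HexChamber.gcEquiv hl hlm).symm x).1, ((HexChamber.gcEquiv hl hlm).symm x).2)

theorem gcCovering_gcMap (D : HexChamber) (c : {c : HexChamber // c.InTriangle l m}) :
    gcCovering hl hlm π (HexChamber.gcMap l m D c.1) = (π D, c) := by
  rw [← HexChamber.gcEquiv_apply hl hlm, gcCovering, Equiv.symm_apply_apply]
  rfl

theorem exists_gcMap_eq (hl : 0 < l) (hlm : l = m ∨ m = 0) (x : HexChamber) :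
    ∃ (D : HexChamber) (c : {c : HexChamber // c.InTriangle l m}), HexChamber.gcMap l m D c.1 = x :=
  ⟨_, _, (HexChamber.gcEquiv hl hlm).apply_symm_apply x⟩

theorem IsCovering.gcCovering (hπ : P.IsCovering π) :
    ((goldbergCoxeter l m hl hlm).apply P).IsCovering (gcCovering hl hlm π) := by
  intro i x
  obtain ⟨D, c, rfl⟩ := exists_gcMap_eq hl hlm x
  rw [gcCovering_gcMap]
  show _ = (goldbergCoxeter l m hl hlm).glue P i (π D, c)
  rcases h : (goldbergCoxeter l m hl hlm).adj i c with c' | k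
  · rw [LocalOperation.glue_inl h, ← HexChamber.gcMap_flip, gcAdj_eq_inl.1 h]
    exact gcCovering_gcMap hl hlm D c'
  · rw [LocalOperation.glue_inr h, ← hπ, ← HexChamber.gcMap_flip_left hlm D
      ((HexChamber.edgeOnSide_iff hl hlm c.2).1 ((gcAdj_eq_inr hl hlm).1 h).2)]
    exact gcCovering_gcMap hl hlm (D.flip k) c

theorem gcCovering_surjective (hs : Function.Surjective π) :
    Function.Surjective (gcCovering hl hlm π) := by
  rintro ⟨C, c⟩
  obtain ⟨D, rfl⟩ := hs C
  exact ⟨_, gcCovering_gcMap hl hlm D c⟩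

theorem gcCovering_translate (hP : P.IsHexagonal) (hπ : P.IsCovering π) {x y : HexChamber}
    (t : ℤ × ℤ) (ht : 3 ∣ t.1 - t.2) (h : gcCovering hl hlm π x = gcCovering hl hlm π y) :
    gcCovering hl hlm π (x.translate t ht) = gcCovering hl hlm π (y.translate t ht) := by
  obtain ⟨D, c, rfl⟩ := exists_gcMap_eq hl hlm x
  obtain ⟨D', c', rfl⟩ := exists_gcMap_eq hl hlm y
  rw [gcCovering_gcMap, gcCovering_gcMap] at h
  obtain rfl : c = c' := congrArg Prod.snd h
  obtain ⟨s, hs, rfl, hinv⟩ := hπ.exists_translate hP (congrArg Prod.fst h)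
  rw [HexChamber.gcMap_translate, HexChamber.translate_comm]
  generalize (HexChamber.gcMap l m D c.1).translate t ht = z
  obtain ⟨E, d, rfl⟩ := exists_gcMap_eq hl hlm z
  rw [← HexChamber.gcMap_translate _ hs, gcCovering_gcMap, gcCovering_gcMap, hinv]

end GoldbergCoxeter

theorem IsHexagonal.increasesSymmetry (hP : P.IsHexagonal) (hc : P.IsConnected) {l m : ℕ}
    (hl : 0 < l) (hlm : l = m ∨ m = 0) (hne : (l, m) ≠ (1, 0)) :
    (goldbergCoxeter l m hl hlm).IncreasesSymmetry P := by
  obtain ⟨C⟩ := hc.1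
  obtain ⟨π, hπ, -⟩ := hP.exists_covering C
  obtain ⟨c, hcf, hct⟩ := HexChamber.exists_inTriangle hl hlm
  obtain ⟨T, hT⟩ := (hπ.gcCovering hl hlm).exists_aut
    (gcCovering_surjective hl hlm (hπ.surjective hc))
    (fun x y t ht h => gcCovering_translate hl hlm hP hπ t ht h) (1, 1) (by norm_num)
  by_contra hle
  have := finite_aut (P := (goldbergCoxeter l m hl hlm).apply P)
  obtain ⟨φ, rfl⟩ := ((Aut.apply_injective (O := goldbergCoxeter l m hl hlm) ⟨⟨c, hct⟩⟩).bijective_of_nat_card_le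
    (not_lt.1 hle)).surjective T
  have h := hT (HexChamber.gcMap l m (HexChamber.std 0 0) c)
  obtain ⟨D, d, hd⟩ := exists_gcMap_eq hl hlm
    ((HexChamber.gcMap l m (HexChamber.std 0 0) c).translate (1, 1) (by norm_num))
  rw [gcCovering_gcMap hl hlm _ ⟨c, hct⟩, ← hd, gcCovering_gcMap] at h
  obtain rfl : ⟨c, hct⟩ = d := congrArg Prod.snd h
  have hf := congrArg HexChamber.f hd
  refine HexChamber.gcScale_ne hl hlm hne D.face_center ?_
  simpa [HexChamber.gcMap, HexFrame.app, HexFrame.lin, HexChamber.translate, hcf, HexChamber.std,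
    gcScale] using hf

theorem IsPolyhedral.isHexagonal (hP : P.IsPolyhedral) (hg : P.HasGenus 1)
    (h6 : ∀ f : P.Face, P.faceSize f = 6) : P.IsHexagonal where
  orientable := hg.2.1
  face _ := card_face_of_size hg.2.1 (h6 _)
  vertex := period_vertex hg hP.threeConnected h6

end SurfaceMap

theorem mainTheorem4 (P : SurfaceMap.{u}) (hP : P.IsPolyhedral) (hg : P.HasGenus 1)
    (h6 : ∀ f : P.Face, P.faceSize f = 6)
    (l m : ℕ) (hl : 0 < l) (hlm : l = m ∨ m = 0) (hne : (l, m) ≠ (1, 0)) :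
    (goldbergCoxeter l m hl hlm).IncreasesSymmetry P :=
  (hP.isHexagonal hg h6).increasesSymmetry hg.1 hl hlm hne
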